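/- Let $n\ge 1$, and let $du$ denote integration with respect to the $(n-1)$-dimensional Hausdorff measure on the unit sphere $S^{n-1}\subset\mathbb{R}^n$. Let $\mathcal{K}_o^n$ be the set of compact convex sets $K\subset\mathbb{R}^n$ containing the origin $o$ in their interior. For $K\in\mathcal{K}_o^n$ and $u\in S^{n-1}$ put $h_K(u)=\sup_{x\in K}\langle u,x\rangle$, $\rho_K(u)=\sup\{\lambda>0:\lambda u\in K\}$ and $H(K,u)=\{x\in\mathbb{R}^n:\langle x,u\rangle=h_K(u)\}$. Let $\alpha_K(u)$ be the unit vector $v$ with $\rho_K(u)u\in H(K,v)$, which is unique for almost every $u\in S^{n-1}$, and for $E\subset S^{n-1}$ let $\boldsymbol{\alpha}^*_K(E)=\{x/|x| : x\in\partial K\cap H(K,v)\text{ for some }v\in E\}$. Let $\phi:\mathbb{R}^n\setminus\{o\}\to(0,\infty)$ be continuous and such that $$\overline{\Phi}(t,u)=\int_t^\infty\phi(ru)\,r^{n-1}\,dr$$ is finite and continuous on $(0,\infty)\times S^{n-1}$. For $v\in S^{n-1}$, $b>0$ and $0<c<1$ let $C(v,b,c)=\{x\in\mathbb{R}^n:|x|\ge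 b\text{ and }\langle x/|x|,v\rangle\ge c\}$, and suppose that for all $v\in S^{n-1}$ and $0<c<1$ $$\lim_{b\to0+}\int_{C(v,b,c)}\phi(x)\,dx=\infty .$$ Let $\psi:(0,\infty)\to(0,\infty)$ be continuous with $\int_1^\infty\frac{\psi(s)}{s}\,ds=\infty$. For $K\in\mathcal{K}_o^n$ and Borel sets $E\subset S^{n-1}$ let $$\widetilde{C}_{\phi,\psi}(K,E)=\frac1n\int_{\boldsymbol{\alpha}^*_K(E)}\frac{\phi(\rho_K(u)u)\,\rho_K(u)^n}{\psi(h_K(\alpha_K(u)))}\,du .$$ Let $\mu$ be a nonzero finite Borel measure on $S^{n-1}$ that is not concentrated on any closed hemisphere, i.e. $\int_{S^{n-1}}\max\{\langle u,v\rangle,0\}\,d\mu(u)>0$ for all $v\in S^{n-1}$, and write $|\mu|=\mu(S^{n-1})$. Then there exists $K\in\mathcal{K}_o^n$ such that $\widetilde{C}_{\phi,\psi}(K,S^{n-1})\ne0$ and $$\frac{\mu(E)}{|\mu|}=\frac{\widetilde{C}_{\phi,\psi}(K,E)}{\widetilde{C}_{\phi,\psi}(K,S^{n-1})}\qquad\text{for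 every Borel set }E\subset S^{n-1}.$$ -/

import Mathlib

open MeasureTheory Set Filter Topology
open scoped ENNReal

noncomputable section

namespace DualOrlicz

/-- Euclidean space `ℝⁿ`. -/
abbrev RSpace (n : ℕ) : Type := EuclideanSpace ℝ (Fin n)

/-- The unit sphere `Sⁿ⁻¹` of `ℝⁿ`. -/
abbrev USphere (n : ℕ) : Type := Metric.sphere (0 : RSpace n) 1

/-- Spherical Lebesgue measure `du` on `Sⁿ⁻¹`, i.e. the `(n-1)`-dimensional Hausdorff measure
with its Euclidean normalization (total mass `n` times the volume of the unit ball). -/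
def sphereMeasure (n : ℕ) : Measure (USphere n) := (volume : Measure (RSpace n)).toSphere

variable {n : ℕ}

/-- The support function `h_K(u) = sup_{x ∈ K} ⟨u, x⟩`. -/
def supportFn (K : Set (RSpace n)) (u : USphere n) : ℝ :=
  sSup ((fun x : RSpace n => inner ℝ (u : RSpace n) x) '' K)

/-- The radial function `ρ_K(u) = sup {s > 0 : s u ∈ K}`. -/
def radialFn (K : Set (RSpace n)) (u : USphere n) : ℝ :=
  sSup {s : ℝ | 0 < s ∧ s • (u : RSpace n) ∈ K}

/-- The supporting hyperplane `H(K, u) = {x : ⟨x, u⟩ = h_K(u)}`. -/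
def supportingHyperplane (K : Set (RSpace n)) (u : USphere n) : Set (RSpace n) :=
  {x | inner ℝ x (u : RSpace n) = supportFn K u}

/-- The set-valued radial Gauss image: all outer unit normals of `K` at the boundary points
`ρ_K(u) u` with `u ∈ A`. -/
def radialGaussImage (K : Set (RSpace n)) (A : Set (USphere n)) : Set (USphere n) :=
  {v | ∃ u ∈ A, radialFn K u • (u : RSpace n) ∈ supportingHyperplane K v}

/-- The reverse radial Gauss image: the directions `x / |x|` of all boundary points `x` of `K`
that have an outer unit normal in `A`. -/
def reverseRadialGaussImage (K : Set (RSpace n)) (A : Set (USphere n)) : Set (USphere n) :=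
  {u | ∃ v ∈ A, ∃ x ∈ frontier K ∩ supportingHyperplane K v,
    (u : RSpace n) = ‖x‖⁻¹ • x}

open Classical in
/-- The radial Gauss map `α_K`: the unique element of the radial Gauss image of `{u}`. The
directions `u` where that image has two or more elements form a null set for a convex body with
the origin in its interior; there the value is immaterial and set to `u`. -/
def radialGaussMap (K : Set (RSpace n)) (u : USphere n) : USphere n :=
  if h : ∃! v, v ∈ radialGaussImage K {u} then h.choose else u

/-- `Φ̄(t, u) = ∫_t^∞ φ(r u) r^{n-1} dr`, with values in `[0, ∞]`. -/
def PhiBar (φ : RSpace n → ℝ) (p : ℝ × USphere n) : ℝ≥0∞ :=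
  ∫⁻ r in Ioi p.1, ENNReal.ofReal (φ (r • (p.2 : RSpace n)) * r ^ (n - 1))

/-- The truncated cone `C(v, b, c) = {x : |x| ≥ b and ⟨x / |x|, v⟩ ≥ c}`. -/
def truncatedCone (v : USphere n) (b c : ℝ) : Set (RSpace n) :=
  {x | b ≤ ‖x‖ ∧ c ≤ inner ℝ (‖x‖⁻¹ • x) (v : RSpace n)}

/-- The `φ`-volume `∫_A φ(x) dx`, with values in `[0, ∞]`. For `A = C(v, b, c)` with `b > 0` it is
`∫_{⟨u, v⟩ ≥ c} Φ̄(b, u) du`. -/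
def phiVolume (φ : RSpace n → ℝ) (A : Set (RSpace n)) : ℝ≥0∞ :=
  ∫⁻ x in A, ENNReal.ofReal (φ x)

/-- The general dual Orlicz curvature measure
`C̃_{φ,ψ}(K, A) = (1/n) ∫_{α*_K(A)} φ(ρ_K(u) u) ρ_K(u)ⁿ / ψ(h_K(α_K(u))) du`. -/
def dualOrliczCurvature (φ : RSpace n → ℝ) (ψ : ℝ → ℝ) (K : Set (RSpace n))
    (A : Set (USphere n)) : ℝ :=
  (1 / (n : ℝ)) * ∫ u in reverseRadialGaussImage K A,
    φ (radialFn K u • (u : RSpace n)) * radialFn K u ^ n / ψ (supportFn K (radialGaussMap K u))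
    ∂(sphereMeasure n)

/-- `μ` is not concentrated on any closed hemisphere: `∫ ⟨u, v⟩₊ dμ(u) > 0` for all `v`. -/
def NotConcentratedOnHemisphere (μ : Measure (USphere n)) : Prop :=
  ∀ v : USphere n, 0 < ∫ u, max (inner ℝ (u : RSpace n) (v : RSpace n)) 0 ∂μ

end DualOrlicz

end

/-! The body is found by minimization. For a positive continuous `f` on the sphere, the Wulff shape
is `{x | ∀ v, ⟨x, v⟩ ≤ f v}`. Its gauge on the sphere is `dualFn f = 1/ρ`, and `dualFn (dualFn f)`
is its support function. With `Ψ(x) = ∫_r^x ψ(s)/s ds`, the energy `∫ Ψ(f) dμ` is minimized over all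
`f` for which the `φ`-volume outside the Wulff shape is at most that outside the unit ball.

Compactness comes from two bounds. The cone hypothesis makes the outer volume large as soon as one
value of `f` is small, so admissible `f` stay above a common `r > 0` (`exists_le_of_dualVolume_le`).
If a support function is large somewhere, its body contains a long segment from the origin, so it is
large on a whole cap; that cap has mass bounded below because `μ` is not concentrated on a
hemisphere, and `Ψ → ∞` then makes the energy large (`exists_le_of_orliczEnergy_le`). Arzelà–Ascoli
and Fatou give a minimizer. Replacing `f` by its bidual keeps the volume and does not raise the
energy, so the minimizer may be taken to be a support function while competitors need not be.

The variations are `f e^{tg}`. By Rademacher's theorem almost every direction `u` has a unique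
normal `α(u)`, and there `log (dualFn (f e^{tg}) u)` has right derivative `-g(α(u))`. Hence the
outer volume has right derivative `-∫ w · (g ∘ α) du`, with `w = φ(ρu)ρⁿ`, and the energy has
derivative `∫ ψ(f) g dμ`. If the first integral `∫ w · (g ∘ α) du` is positive, the perturbation is
admissible for small `t > 0`, so the second is nonnegative. Two functionals in this relation are
proportional (`exists_pos_eq_smul`). Testing with `g / ψ(f)` identifies `μ` with a multiple of the
image under `α` of `w / ψ(f ∘ α) du`, which is the curvature measure up to a constant. -/

namespace DualOrlicz

variable {n : ℕ}

/-! ### Gauges of Wulff shapes and polar duality -/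

/-- Positive continuous functions on the sphere. -/
structure PosCont (f : USphere n → ℝ) : Prop where
  cont : Continuous f
  pos : ∀ v, 0 < f v

/-- The gauge `x ↦ sup_v ⟨x, v⟩ / f(v)` of the Wulff shape `{x | ∀ v, ⟨x, v⟩ ≤ f v}` of `f`. -/
noncomputable def polarFn (f : USphere n → ℝ) (x : RSpace n) : ℝ :=
  ⨆ v : USphere n, inner ℝ x (v : RSpace n) / f v

/-- The gauge of the Wulff shape of `f`, restricted to the sphere. -/
noncomputable def dualFn (f : USphere n → ℝ) : USphere n → ℝ := fun u => polarFn f (u : RSpace n)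

theorem polarFn_smul (f : USphere n → ℝ) {s : ℝ} (hs : 0 ≤ s) (x : RSpace n) :
    polarFn f (s • x) = s * polarFn f x := by
  simp only [polarFn, real_inner_smul_left, mul_div_assoc]
  exact (Real.mul_iSup_of_nonneg hs _).symm

theorem norm_coe_sphere (v : USphere n) : ‖(v : RSpace n)‖ = 1 := by
  simp

theorem abs_inner_sphere_le (x : RSpace n) (v : USphere n) :
    |inner ℝ x (v : RSpace n)| ≤ ‖x‖ := by
  simpa [norm_coe_sphere] using abs_real_inner_le_norm x (v : RSpace n)

theorem inner_self_sphere (v : USphere n) : inner ℝ (v : RSpace n) (v : RSpace n) = 1 := by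
  rw [real_inner_self_eq_norm_sq, norm_coe_sphere, one_pow]

theorem nonempty_sphere (hn : 1 ≤ n) : Nonempty (USphere n) := by
  have : Nonempty (Fin n) := ⟨⟨0, hn⟩⟩
  exact (NormedSpace.sphere_nonempty.2 zero_le_one).to_subtype

namespace PosCont

variable {f g : USphere n → ℝ}

theorem continuous_div (hf : PosCont f) (x : RSpace n) :
    Continuous fun v : USphere n => inner ℝ x (v : RSpace n) / f v :=
  (continuous_const.inner continuous_subtype_val).div hf.cont fun v => (hf.pos v).ne'

theorem le_polarFn (hf : PosCont f) (x : RSpace n) (v : USphere n) :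
    inner ℝ x (v : RSpace n) / f v ≤ polarFn f x :=
  le_ciSup (isCompact_range (hf.continuous_div x)).bddAbove v

theorem inner_le (hf : PosCont f) (x : RSpace n) (v : USphere n) :
    inner ℝ x (v : RSpace n) ≤ polarFn f x * f v :=
  (div_le_iff₀ (hf.pos v)).1 (hf.le_polarFn x v)

theorem inv_le_dualFn (hf : PosCont f) (u : USphere n) : (f u)⁻¹ ≤ dualFn f u := by
  simpa [inner_self_sphere, dualFn] using hf.le_polarFn (u : RSpace n) u

variable [Nonempty (USphere n)]

/-- Compactness of the sphere: the supremum is attained, so every direction has at least one normal.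
-/
theorem exists_eq_polarFn (hf : PosCont f) (x : RSpace n) :
    ∃ v : USphere n, inner ℝ x (v : RSpace n) = polarFn f x * f v := by
  obtain ⟨v, -, hv⟩ := isCompact_univ.exists_isMaxOn univ_nonempty
    (hf.continuous_div x).continuousOn
  refine ⟨v, ?_⟩
  rw [← div_eq_iff (hf.pos v).ne']
  exact le_antisymm (hf.le_polarFn x v) (ciSup_le fun w => hv (mem_univ w))

theorem polarFn_le_iff (hf : PosCont f) {x : RSpace n} {c : ℝ} :
    polarFn f x ≤ c ↔ ∀ v : USphere n, inner ℝ x (v : RSpace n) ≤ c * f v := by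
  refine ⟨fun h v => (hf.inner_le x v).trans
    (mul_le_mul_of_nonneg_right h (hf.pos v).le), fun h => ciSup_le fun v => ?_⟩
  exact (div_le_iff₀ (hf.pos v)).2 (h v)

theorem exists_pos_le (hf : PosCont f) : ∃ r > 0, ∀ v, r ≤ f v := by
  obtain ⟨v, -, hv⟩ := isCompact_univ.exists_isMinOn univ_nonempty hf.cont.continuousOn
  exact ⟨f v, hf.pos v, fun w => hv (mem_univ w)⟩

theorem exists_le (hf : PosCont f) : ∃ R > 0, ∀ v, f v ≤ R := by
  obtain ⟨v, -, hv⟩ := isCompact_univ.exists_isMaxOn univ_nonempty hf.cont.continuousOn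
  exact ⟨f v, hf.pos v, fun w => hv (mem_univ w)⟩

theorem polarFn_sub_le (hf : PosCont f) {r : ℝ} (hr : 0 < r) (hrf : ∀ v, r ≤ f v)
    (x y : RSpace n) : polarFn f x ≤ polarFn f y + r⁻¹ * ‖x - y‖ := by
  refine hf.polarFn_le_iff.2 fun v => ?_
  have h1 := hf.inner_le y v
  have h2 := (le_abs_self _).trans (abs_inner_sphere_le (x - y) v)
  rw [inner_sub_left] at h2
  have h3 : ‖x - y‖ ≤ r⁻¹ * ‖x - y‖ * f v := by
    have : r⁻¹ * ‖x - y‖ * r ≤ r⁻¹ * ‖x - y‖ * f v :=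
      mul_le_mul_of_nonneg_left (hrf v) (by positivity)
    rwa [mul_right_comm, inv_mul_cancel₀ hr.ne', one_mul] at this
  linarith

theorem lipschitzWith_polarFn (hf : PosCont f) {r : ℝ} (hr : 0 < r) (hrf : ∀ v, r ≤ f v) :
    LipschitzWith (Real.toNNReal r⁻¹) (polarFn f) := by
  refine LipschitzWith.of_le_add_mul _ fun x y => ?_
  rw [Real.coe_toNNReal _ (by positivity), dist_eq_norm]
  exact hf.polarFn_sub_le hr hrf x y

theorem lipschitzWith_dualFn (hf : PosCont f) {r : ℝ} (hr : 0 < r) (hrf : ∀ v, r ≤ f v) :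
    LipschitzWith (Real.toNNReal r⁻¹) (dualFn f) := by
  rw [← mul_one (Real.toNNReal r⁻¹)]
  exact (hf.lipschitzWith_polarFn hr hrf).comp (LipschitzWith.subtype_val _)

theorem continuous_polarFn (hf : PosCont f) : Continuous (polarFn f) :=
  let ⟨_, hr, hrf⟩ := hf.exists_pos_le
  (hf.lipschitzWith_polarFn hr hrf).continuous

theorem dual (hf : PosCont f) : PosCont (dualFn f) where
  cont := hf.continuous_polarFn.comp continuous_subtype_val
  pos u := (inv_pos.2 (hf.pos u)).trans_le (hf.inv_le_dualFn u)

theorem dualFn_le (hf : PosCont f) {r : ℝ} (hr : 0 < r) (hrf : ∀ v, r ≤ f v) (u : USphere n) :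
    dualFn f u ≤ r⁻¹ := by
  refine hf.polarFn_le_iff.2 fun v => ?_
  have h2 := (le_abs_self _).trans (abs_inner_sphere_le (u : RSpace n) v)
  rw [norm_coe_sphere] at h2
  refine h2.trans ?_
  rw [inv_mul_eq_div, one_le_div hr]
  exact hrf v

theorem dualFn_anti (hf : PosCont f) (hg : PosCont g) (h : ∀ v, f v ≤ g v) (u : USphere n) :
    dualFn g u ≤ dualFn f u :=
  hg.polarFn_le_iff.2 fun v => (hf.inner_le _ v).trans
    (mul_le_mul_of_nonneg_left (h v) (hf.dual.pos u).le)

/-- The inequality `⟨u, v⟩ ≤ dualFn f u * f v` is symmetric in the two functions, so `f` is one of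
the bounds over which the bidual is smallest. -/
theorem dualFn_dualFn_le (hf : PosCont f) (v : USphere n) : dualFn (dualFn f) v ≤ f v := by
  refine hf.dual.polarFn_le_iff.2 fun u => ?_
  rw [real_inner_comm, mul_comm]
  exact hf.inner_le _ v

/-- The Galois-connection argument: passing to the bidual does not change the Wulff shape. -/
theorem dualFn_dualFn_dualFn (hf : PosCont f) : dualFn (dualFn (dualFn f)) = dualFn f :=
  funext fun u => le_antisymm (hf.dual.dualFn_dualFn_le u)
    (hf.dual.dual.dualFn_anti hf hf.dualFn_dualFn_le u)

theorem dualFn_le_add (hf : PosCont f) (hg : PosCont g) {r : ℝ} (hr : 0 < r) (hrf : ∀ v, r ≤ f v)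
    (hrg : ∀ v, r ≤ g v) {δ : ℝ} (hfg : ∀ v, |f v - g v| ≤ δ) (u : USphere n) :
    dualFn f u ≤ dualFn g u + r⁻¹ * r⁻¹ * δ := by
  refine hf.polarFn_le_iff.2 fun v => ?_
  have h1 := hg.inner_le (u : RSpace n) v
  have h2 : polarFn g (u : RSpace n) ≤ r⁻¹ := hg.dualFn_le hr hrg u
  have h0 : 0 < polarFn g (u : RSpace n) := hg.dual.pos u
  have h3 := hfg v
  have hδ : 0 ≤ δ := (abs_nonneg _).trans h3
  have h4 := neg_le_of_abs_le h3
  have h5 : polarFn g (u : RSpace n) * (g v - f v) ≤ r⁻¹ * δ :=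
    (mul_le_mul_of_nonneg_left (by linarith) h0.le).trans (mul_le_mul_of_nonneg_right h2 hδ)
  have h6 : r⁻¹ * r⁻¹ * δ * r ≤ r⁻¹ * r⁻¹ * δ * f v :=
    mul_le_mul_of_nonneg_left (hrf v) (by positivity)
  have h7 : r⁻¹ * r⁻¹ * δ * r = r⁻¹ * δ := by field_simp
  simp only [dualFn]
  nlinarith

theorem abs_dualFn_sub_le (hf : PosCont f) (hg : PosCont g) {r : ℝ} (hr : 0 < r)
    (hrf : ∀ v, r ≤ f v) (hrg : ∀ v, r ≤ g v) {δ : ℝ} (hfg : ∀ v, |f v - g v| ≤ δ)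
    (u : USphere n) : |dualFn f u - dualFn g u| ≤ r⁻¹ * r⁻¹ * δ := by
  have h1 := hf.dualFn_le_add hg hr hrf hrg hfg u
  have h2 := hg.dualFn_le_add hf hr hrg hrf (fun v => by rw [abs_sub_comm]; exact hfg v) u
  rw [abs_le]
  constructor <;> linarith

end PosCont

/-- The contact set: normals `v` at the boundary point of the Wulff shape in direction `u`. -/
def IsNormal (f : USphere n → ℝ) (u v : USphere n) : Prop :=
  inner ℝ (u : RSpace n) (v : RSpace n) = dualFn f u * f v

/-- Almost every direction has exactly one normal. -/
theorem ae_existsUnique_isNormal [Nonempty (USphere n)] {f : USphere n → ℝ} (hf : PosCont f) :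
    ∀ᵐ u ∂(sphereMeasure n), ∃! v, IsNormal f u v := by
  obtain ⟨r, hr, hrf⟩ := hf.exists_pos_le
  have hL := hf.lipschitzWith_polarFn hr hrf
  have hae : ∀ᵐ x : RSpace n, DifferentiableAt ℝ (polarFn f) x := hL.ae_differentiableAt
  have hmeas : MeasurableSet {u : USphere n | DifferentiableAt ℝ (polarFn f) (u : RSpace n)} :=
    (measurableSet_of_differentiableAt ℝ (polarFn f)).preimage measurable_subtype_coe
  have hdiff : ∀ᵐ u : USphere n ∂(sphereMeasure n), DifferentiableAt ℝ (polarFn f) (u : RSpace n) := by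
    rw [ae_iff, ← compl_ofPred, sphereMeasure, Measure.toSphere_apply' _ hmeas.compl]
    -- The spherical measure of a set is a multiple of the volume of the cone over it. By
    -- homogeneity `polarFn f` is not differentiable anywhere on the cone over the bad directions,
    -- and Rademacher's theorem makes that cone null.
    refine mul_eq_zero_of_right _ (measure_mono_null ?_ (ae_iff.1 hae))
    rintro _ ⟨s, hs, _, ⟨u, hu, rfl⟩, rfl⟩ hd
    refine hu ?_
    have hs0 : s ≠ 0 := hs.1.ne'
    have h1 : DifferentiableAt ℝ (fun y : RSpace n => polarFn f (s • y)) (u : RSpace n) :=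
      DifferentiableAt.comp (g := polarFn f) (f := fun y : RSpace n => s • y) (u : RSpace n) hd
        (differentiableAt_id.const_smul s)
    have h2 : polarFn f = fun y : RSpace n => s⁻¹ * polarFn f (s • y) := by
      funext y
      rw [polarFn_smul f hs.1.le, inv_mul_cancel_left₀ hs0]
    simp only [mem_ofPred_eq]
    rw [h2]
    exact h1.const_mul _
  filter_upwards [hdiff] with u hu
  obtain ⟨v, hv⟩ := hf.exists_eq_polarFn (u : RSpace n)
  have key : ∀ w : USphere n, IsNormal f u w →
      fderiv ℝ (polarFn f) (u : RSpace n) = (f w)⁻¹ • innerSL ℝ (w : RSpace n) := by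
    intro w hw
    -- The linear function `⟨·, w⟩ / f w` lies below the gauge and touches it at `u`, so it must be
    -- the derivative there.
    have hmin : IsLocalMin
        (fun y : RSpace n => polarFn f y - ((f w)⁻¹ • innerSL ℝ (w : RSpace n)) y)
        (u : RSpace n) := by
      refine Eventually.of_forall fun y => ?_
      have h1 := hf.le_polarFn y w
      have h2 : inner ℝ (u : RSpace n) (w : RSpace n) / f w = polarFn f u :=
        (div_eq_iff (hf.pos w).ne').2 hw
      simp only [_root_.smul_apply, innerSL_apply_apply, smul_eq_mul]
      rw [real_inner_comm, inv_mul_eq_div, h2, real_inner_comm, inv_mul_eq_div]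
      linarith
    have h3 := hmin.fderiv_eq_zero
    rw [fderiv_fun_sub hu (ContinuousLinearMap.differentiableAt _),
      ContinuousLinearMap.fderiv, sub_eq_zero] at h3
    exact h3
  refine ⟨v, hv, fun w hw => ?_⟩
  have h := (key w hw).symm.trans (key v hv)
  have h4 : (f w)⁻¹ • (w : RSpace n) = (f v)⁻¹ • (v : RSpace n) := by
    refine ext_inner_right ℝ fun y => ?_
    have := DFunLike.congr_fun h y
    simpa [inner_smul_left] using this
  -- Both vectors are unit, so norms give `f w = f v`, and then `w = v`.
  have h5 := congrArg norm h4
  rw [norm_smul, norm_smul, norm_coe_sphere, norm_coe_sphere, mul_one, mul_one,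
    Real.norm_of_nonneg (inv_pos.2 (hf.pos w)).le, Real.norm_of_nonneg (inv_pos.2 (hf.pos v)).le]
    at h5
  rw [h5] at h4
  exact Subtype.ext (smul_right_injective _ (inv_pos.2 (hf.pos v)).ne' h4)

end DualOrlicz

/-! ### The dual volume: polar coordinates, lower bound, regularity -/

namespace DualOrlicz

variable {n : ℕ}

/-- The standing assumptions on the density `φ` apart from its behaviour near the origin. -/
structure Admissible (φ : RSpace n → ℝ) : Prop where
  cont : ContinuousOn φ {x | x ≠ 0}
  pos : ∀ x, x ≠ 0 → 0 < φ x
  finite : ∀ t : ℝ, 0 < t → ∀ u : USphere n, PhiBar φ (t, u) ≠ ∞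
  contPhiBar : ContinuousOn (PhiBar φ) (Ioi (0 : ℝ) ×ˢ univ)

/-- The `φ`-volume of the complement of the Wulff shape of `f`. -/
noncomputable def dualVolume (φ : RSpace n → ℝ) (f : USphere n → ℝ) : ℝ≥0∞ :=
  ∫⁻ u : USphere n, PhiBar φ ((dualFn f u)⁻¹, u) ∂(sphereMeasure n)

instance : IsFiniteMeasure (sphereMeasure n) := by
  unfold sphereMeasure; infer_instance

instance : (sphereMeasure n).IsOpenPosMeasure := by
  unfold sphereMeasure; infer_instance

theorem PhiBar_anti (φ : RSpace n → ℝ) (u : USphere n) {s t : ℝ} (hst : s ≤ t) :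
    PhiBar φ (t, u) ≤ PhiBar φ (s, u) :=
  lintegral_mono_set (Ioi_subset_Ioi hst)

theorem smul_sphere_ne_zero {r : ℝ} (hr : r ≠ 0) (u : USphere n) : r • (u : RSpace n) ≠ 0 := by
  have : (u : RSpace n) ≠ 0 := by
    rw [← norm_ne_zero_iff, norm_coe_sphere]; exact one_ne_zero
  exact smul_ne_zero hr this

theorem measurableSet_truncatedCone (v : USphere n) (b c : ℝ) :
    MeasurableSet (truncatedCone v b c) := by
  have h : Measurable fun x : RSpace n => inner ℝ (‖x‖⁻¹ • x) (v : RSpace n) :=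
    Measurable.inner (by fun_prop) measurable_const
  exact (measurableSet_le measurable_const measurable_norm).inter
    (measurableSet_le measurable_const h)

theorem smul_mem_truncatedCone {u v : USphere n} {b c r : ℝ} (hr : 0 < r) :
    r • (u : RSpace n) ∈ truncatedCone v b c ↔
      b ≤ r ∧ c ≤ inner ℝ (u : RSpace n) (v : RSpace n) := by
  simp only [truncatedCone, mem_ofPred_eq, norm_smul, norm_coe_sphere, mul_one,
    Real.norm_of_nonneg hr.le, smul_smul, inv_mul_cancel₀ hr.ne', one_smul]

theorem lintegral_indicator_truncatedCone_ray (φ : RSpace n → ℝ) (u v : USphere n) {b : ℝ}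
    (hb : 0 < b) (c : ℝ) :
    ∫⁻ r in Ioi (0 : ℝ), ENNReal.ofReal (r ^ (n - 1)) *
        (truncatedCone v b c).indicator (fun x => ENNReal.ofReal (φ x)) (r • (u : RSpace n)) =
      {u : USphere n | c ≤ inner ℝ (u : RSpace n) (v : RSpace n)}.indicator
        (fun u => PhiBar φ (b, u)) u := by
  by_cases hu : c ≤ inner ℝ (u : RSpace n) (v : RSpace n)
  · have e : PhiBar φ (b, u) =
        ∫⁻ r in Ici b, ENNReal.ofReal (φ (r • (u : RSpace n)) * r ^ (n - 1)) :=
      setLIntegral_congr Ioi_ae_eq_Ici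
    rw [indicator_of_mem (by exact hu), e, ← lintegral_indicator measurableSet_Ioi,
      ← lintegral_indicator measurableSet_Ici]
    refine lintegral_congr fun r => ?_
    by_cases hr : b ≤ r
    · have hr0 : 0 < r := hb.trans_le hr
      rw [indicator_of_mem (mem_Ioi.2 hr0), indicator_of_mem (mem_Ici.2 hr),
        indicator_of_mem ((smul_mem_truncatedCone hr0).2 ⟨hr, hu⟩), mul_comm (φ _),
        ENNReal.ofReal_mul (by positivity)]
    · rw [indicator_of_notMem (s := Ici b) (mt mem_Ici.1 hr)]
      by_cases hr0 : 0 < r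
      · rw [indicator_of_mem (mem_Ioi.2 hr0),
          indicator_of_notMem (fun h => hr ((smul_mem_truncatedCone hr0).1 h).1), mul_zero]
      · rw [indicator_of_notMem (mt mem_Ioi.1 hr0)]
  · rw [indicator_of_notMem (by exact hu)]
    refine (setLIntegral_congr_fun measurableSet_Ioi fun r hr => ?_).trans lintegral_zero
    rw [indicator_of_notMem (fun h => hu ((smul_mem_truncatedCone hr).1 h).2), mul_zero]

/-- Measurability is asked only away from the origin, since nothing is known about `φ` at `0`. -/
theorem lintegral_polar (hn : 1 ≤ n) {G : RSpace n → ℝ≥0∞}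
    (hG : Measurable fun x : ({(0 : RSpace n)}ᶜ : Set (RSpace n)) => G x) :
    ∫⁻ x, G x = ∫⁻ u : USphere n, (∫⁻ r in Ioi (0 : ℝ),
      ENNReal.ofReal (r ^ (n - 1)) * G (r • (u : RSpace n))) ∂(sphereMeasure n) := by
  have : Nonempty (Fin n) := ⟨⟨0, hn⟩⟩
  have hG' : Measurable fun p : USphere n × Ioi (0 : ℝ) => G ((p.2 : ℝ) • (p.1 : RSpace n)) :=
    hG.comp (homeomorphUnitSphereProd (RSpace n)).symm.measurable
  have hmp := (volume : Measure (RSpace n)).measurePreserving_homeomorphUnitSphereProd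
  have hdim : Module.finrank ℝ (RSpace n) = n := by simp
  calc ∫⁻ x, G x = ∫⁻ x in {(0 : RSpace n)}ᶜ, G x := by rw [restrict_compl_singleton]
    _ = ∫⁻ x : ({(0 : RSpace n)}ᶜ : Set (RSpace n)), G x ∂(volume.comap Subtype.val) :=
      (lintegral_subtype_comap (measurableSet_singleton _).compl _).symm
    _ = ∫⁻ x : ({(0 : RSpace n)}ᶜ : Set (RSpace n)),
          (fun p : USphere n × Ioi (0 : ℝ) => G ((p.2 : ℝ) • (p.1 : RSpace n)))
            (homeomorphUnitSphereProd (RSpace n) x) ∂(volume.comap Subtype.val) := by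
      refine lintegral_congr fun x => ?_
      have := congrArg Subtype.val ((homeomorphUnitSphereProd (RSpace n)).symm_apply_apply x)
      simp only [homeomorphUnitSphereProd_symm_apply_coe] at this
      exact congrArg G this.symm
    _ = ∫⁻ p : USphere n × Ioi (0 : ℝ), G ((p.2 : ℝ) • (p.1 : RSpace n))
          ∂((volume : Measure (RSpace n)).toSphere.prod
            (Measure.volumeIoiPow (Module.finrank ℝ (RSpace n) - 1))) :=
      hmp.lintegral_comp hG'
    _ = ∫⁻ u : USphere n, ∫⁻ r : Ioi (0 : ℝ), G ((r : ℝ) • (u : RSpace n))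
          ∂(Measure.volumeIoiPow (n - 1)) ∂(sphereMeasure n) := by
      rw [lintegral_prod _ hG'.aemeasurable, hdim]; rfl
    _ = _ := by
      refine lintegral_congr fun u => ?_
      have hGu : Measurable fun r : Ioi (0 : ℝ) => G ((r : ℝ) • (u : RSpace n)) :=
        hG'.comp measurable_prodMk_left
      rw [Measure.volumeIoiPow, lintegral_withDensity_eq_lintegral_mul _ (by fun_prop) hGu]
      exact lintegral_subtype_comap measurableSet_Ioi
        (fun r : ℝ => ENNReal.ofReal (r ^ (n - 1)) * G (r • (u : RSpace n)))

theorem phiVolume_truncatedCone {φ : RSpace n → ℝ} (hφ : ContinuousOn φ {x | x ≠ 0}) (hn : 1 ≤ n)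
    (v : USphere n) {b : ℝ} (hb : 0 < b) (c : ℝ) :
    phiVolume φ (truncatedCone v b c) =
      ∫⁻ u in {u : USphere n | c ≤ inner ℝ (u : RSpace n) (v : RSpace n)}, PhiBar φ (b, u)
        ∂(sphereMeasure n) := by
  have hA := measurableSet_truncatedCone v b c
  have hS : MeasurableSet {u : USphere n | c ≤ inner ℝ (u : RSpace n) (v : RSpace n)} :=
    measurableSet_le measurable_const (measurable_subtype_coe.inner measurable_const)
  have hm : Measurable fun x : ({(0 : RSpace n)}ᶜ : Set (RSpace n)) =>
      (truncatedCone v b c).indicator (fun x => ENNReal.ofReal (φ x)) (x : RSpace n) := by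
    have h1 : Measurable fun x : ({(0 : RSpace n)}ᶜ : Set (RSpace n)) => ENNReal.ofReal (φ x) :=
      (ENNReal.continuous_ofReal.comp (hφ.domRestrict (s := {x | x ≠ 0}))).measurable
    exact h1.indicator (hA.preimage measurable_subtype_coe)
  rw [phiVolume, ← lintegral_indicator hA, lintegral_polar hn hm, ← lintegral_indicator hS]
  exact lintegral_congr fun u => lintegral_indicator_truncatedCone_ray φ u v hb c

namespace Admissible

variable {φ : RSpace n → ℝ} {f : USphere n → ℝ}

theorem continuous_PhiBar_comp (hφ : Admissible φ) {ρ : USphere n → ℝ} (hρ : PosCont ρ) :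
    Continuous fun u => PhiBar φ (ρ u, u) :=
  hφ.contPhiBar.comp_continuous (hρ.cont.prodMk continuous_id) fun u => ⟨hρ.pos u, mem_univ u⟩

end Admissible

theorem PosCont.inv {f : USphere n → ℝ} (hf : PosCont f) : PosCont fun u => (f u)⁻¹ where
  cont := hf.cont.inv₀ fun v => (hf.pos v).ne'
  pos v := inv_pos.2 (hf.pos v)

namespace Admissible

variable {φ : RSpace n → ℝ} {f : USphere n → ℝ}

theorem exists_PhiBar_le [Nonempty (USphere n)] (hφ : Admissible φ) {t : ℝ} (ht : 0 < t) :
    ∃ C : ℝ≥0∞, C ≠ ∞ ∧ ∀ s, t ≤ s → ∀ u, PhiBar φ (s, u) ≤ C := by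
  obtain ⟨u, -, hu⟩ := isCompact_univ.exists_isMaxOn univ_nonempty
    (hφ.continuous_PhiBar_comp (ρ := fun _ => t) ⟨continuous_const, fun _ => ht⟩).continuousOn
  exact ⟨PhiBar φ (t, u), hφ.finite t ht u, fun s hs w =>
    (PhiBar_anti φ w hs).trans (hu (mem_univ w))⟩

theorem dualVolume_ne_top [Nonempty (USphere n)] (hφ : Admissible φ) (hf : PosCont f) :
    dualVolume φ f ≠ ∞ := by
  obtain ⟨r, hr, hrf⟩ := hf.dual.inv.exists_pos_le
  obtain ⟨C, hC, h⟩ := hφ.exists_PhiBar_le hr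
  refine ((lintegral_mono fun u => h _ (hrf u) u).trans_lt ?_).ne
  rw [lintegral_const]
  exact ENNReal.mul_lt_top hC.lt_top (measure_lt_top _ _)

/-- A bound on the `φ`-volume of the complement forces the support function away from zero. -/
theorem exists_le_of_dualVolume_le [Nonempty (USphere n)] (hφ : Admissible φ) (hn : 1 ≤ n)
    (hcone : ∀ (v : USphere n) (c : ℝ), 0 < c → c < 1 →
      Tendsto (fun b : ℝ => phiVolume φ (truncatedCone v b c)) (𝓝[>] 0) (𝓝 ∞))
    {M : ℝ≥0∞} (hM : M ≠ ∞) :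
    ∃ r > 0, ∀ f : USphere n → ℝ, PosCont f → dualVolume φ f ≤ M → ∀ v, r ≤ f v := by
  suffices h : ∃ r > 0, ∀ v ∈ (univ : Set (USphere n)), ∀ f : USphere n → ℝ, PosCont f →
      dualVolume φ f ≤ M → r ≤ f v by
    obtain ⟨r, hr, h⟩ := h
    exact ⟨r, hr, fun f hf hV v => h v (mem_univ v) f hf hV⟩
  refine isCompact_univ.induction_on (p := fun s => ∃ r > 0, ∀ v ∈ s, ∀ f : USphere n → ℝ,
      PosCont f → dualVolume φ f ≤ M → r ≤ f v) ⟨1, one_pos, fun v hv => hv.elim⟩ ?_ ?_ ?_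
  · rintro s t hst ⟨r, hr, h⟩
    exact ⟨r, hr, fun v hv => h v (hst hv)⟩
  · rintro s t ⟨r, hr, h⟩ ⟨r', hr', h'⟩
    refine ⟨min r r', lt_min hr hr', ?_⟩
    rintro v (hv | hv) f hf hV
    · exact (min_le_left _ _).trans (h v hv f hf hV)
    · exact (min_le_right _ _).trans (h' v hv f hf hV)
  · intro v₀ _
    -- For `⟨u, v₀⟩ ≥ 3/4` and `|v - v₀| < 1/4` one has `⟨u, v⟩ ≥ 1/2`. If `f v < b/2`, the
    -- constraint at `v` then forces `ρ(u) ≤ b`, so the outer volume is at least that of the cone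
    -- `C(v₀, b, 3/4)`, which exceeds `M`.
    have h1 := (hcone v₀ (3 / 4) (by norm_num) (by norm_num)).eventually_const_lt hM.lt_top
    obtain ⟨b, hbM, hb⟩ := (h1.and self_mem_nhdsWithin).exists
    have hb : 0 < b := hb
    refine ⟨Metric.ball v₀ (1 / 4), mem_nhdsWithin_of_mem_nhds (Metric.ball_mem_nhds _ (by norm_num)),
      b / 2, by positivity, fun v hv f hf hV => ?_⟩
    by_contra hlt
    rw [not_le] at hlt
    refine absurd hV (not_le.2 (hbM.trans_le ?_))
    rw [phiVolume_truncatedCone hφ.cont hn v₀ hb]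
    refine (setLIntegral_mono' (measurableSet_le measurable_const
      (measurable_subtype_coe.inner measurable_const)) fun u hu => ?_).trans
      (setLIntegral_le_lintegral _ _)
    refine PhiBar_anti φ u ?_
    have hu : (3 / 4 : ℝ) ≤ inner ℝ (u : RSpace n) (v₀ : RSpace n) := hu
    have h2 := (neg_le_of_abs_le (abs_real_inner_le_norm (u : RSpace n) (v - v₀ : RSpace n)))
    rw [norm_coe_sphere, one_mul, inner_sub_right] at h2
    have h3 : ‖(v - v₀ : RSpace n)‖ < 1 / 4 := by
      rw [← dist_eq_norm]; exact hv
    have h4 := hf.inner_le (u : RSpace n) v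
    have h5 : (1 / 2 : ℝ) ≤ dualFn f u * (b / 2) :=
      le_trans (by linarith) (h4.trans (mul_le_mul_of_nonneg_left hlt.le (hf.dual.pos u).le))
    rw [inv_le_iff_one_le_mul₀ (hf.dual.pos u)]
    linarith

/-- Fatou's lemma: the volume constraint survives pointwise convergence of the gauges. -/
theorem dualVolume_le_of_tendsto [Nonempty (USphere n)] (hφ : Admissible φ)
    {F : ℕ → USphere n → ℝ} (hF : ∀ k, PosCont (F k)) (hf : PosCont f)
    (hlim : ∀ u, Tendsto (fun k => dualFn (F k) u) atTop (𝓝 (dualFn f u)))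
    {M : ℝ≥0∞} (hM : ∀ k, dualVolume φ (F k) ≤ M) : dualVolume φ f ≤ M := by
  have h1 : ∀ u : USphere n, Tendsto (fun k => PhiBar φ ((dualFn (F k) u)⁻¹, u)) atTop
      (𝓝 (PhiBar φ ((dualFn f u)⁻¹, u))) := by
    intro u
    have h0 : 0 < (dualFn f u)⁻¹ := inv_pos.2 (hf.dual.pos u)
    have h2 := (hφ.contPhiBar ((dualFn f u)⁻¹, u) ⟨h0, mem_univ u⟩).continuousAt
      (prod_mem_nhds (Ioi_mem_nhds h0) univ_mem)
    exact h2.tendsto.comp (((hlim u).inv₀ (hf.dual.pos u).ne').prodMk_nhds tendsto_const_nhds)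
  calc dualVolume φ f
      = ∫⁻ u, liminf (fun k => PhiBar φ ((dualFn (F k) u)⁻¹, u)) atTop ∂(sphereMeasure n) :=
        lintegral_congr fun u => (h1 u).liminf_eq.symm
    _ ≤ liminf (fun k => dualVolume φ (F k)) atTop :=
        lintegral_liminf_le fun k => (hφ.continuous_PhiBar_comp (hF k).dual.inv).measurable
    _ ≤ M := (liminf_le_liminf (Eventually.of_forall hM)).trans (liminf_const M).le

theorem continuousOn_radial (hφ : Admissible φ) :
    ContinuousOn (fun p : ℝ × USphere n => φ (p.1 • (p.2 : RSpace n)) * p.1 ^ (n - 1))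
      (Ioi (0 : ℝ) ×ˢ univ) := by
  refine ContinuousOn.mul (hφ.cont.comp (by fun_prop) fun p hp => ?_) (by fun_prop)
  exact smul_sphere_ne_zero (ne_of_gt hp.1) _

theorem continuousOn_ray (hφ : Admissible φ) (u : USphere n) :
    ContinuousOn (fun r : ℝ => φ (r • (u : RSpace n)) * r ^ (n - 1)) (Ioi 0) :=
  hφ.continuousOn_radial.comp (f := fun r : ℝ => (r, u)) (by fun_prop) fun r hr => ⟨hr, mem_univ _⟩

theorem ray_pos (hφ : Admissible φ) (u : USphere n) {r : ℝ} (hr : 0 < r) :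
    0 < φ (r • (u : RSpace n)) * r ^ (n - 1) :=
  mul_pos (hφ.pos _ (smul_sphere_ne_zero hr.ne' u)) (by positivity)

theorem integrableOn_ray (hφ : Admissible φ) (u : USphere n) {t : ℝ} (ht : 0 < t) :
    IntegrableOn (fun r : ℝ => φ (r • (u : RSpace n)) * r ^ (n - 1)) (Ioi t) := by
  refine ⟨((hφ.continuousOn_ray u).mono (Ioi_subset_Ioi ht.le)).aestronglyMeasurable
    measurableSet_Ioi, ?_⟩
  rw [hasFiniteIntegral_iff_ofReal]
  · exact (hφ.finite t ht u).lt_top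
  · exact (ae_restrict_iff' measurableSet_Ioi).2
      (Eventually.of_forall fun r hr => (hφ.ray_pos u (ht.trans hr)).le)

theorem toReal_PhiBar (hφ : Admissible φ) (u : USphere n) {t : ℝ} (ht : 0 < t) :
    (PhiBar φ (t, u)).toReal = ∫ r in Ioi t, φ (r • (u : RSpace n)) * r ^ (n - 1) := by
  rw [integral_eq_lintegral_of_nonneg_ae]
  · rfl
  · exact (ae_restrict_iff' measurableSet_Ioi).2
      (Eventually.of_forall fun r hr => (hφ.ray_pos u (ht.trans hr)).le)
  · exact (hφ.integrableOn_ray u ht).1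

theorem toReal_PhiBar_sub (hφ : Admissible φ) (u : USphere n) {s t : ℝ} (hs : 0 < s) (ht : 0 < t) :
    (PhiBar φ (t, u)).toReal - (PhiBar φ (s, u)).toReal =
      ∫ r in t..s, φ (r • (u : RSpace n)) * r ^ (n - 1) := by
  rw [hφ.toReal_PhiBar u hs, hφ.toReal_PhiBar u ht,
    intervalIntegral.integral_Ioi_sub_Ioi' (hφ.integrableOn_ray u ht) (hφ.integrableOn_ray u hs)]

theorem hasDerivAt_toReal_PhiBar (hφ : Admissible φ) (u : USphere n) {t : ℝ} (ht : 0 < t) :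
    HasDerivAt (fun s => (PhiBar φ (s, u)).toReal)
      (-(φ (t • (u : RSpace n)) * t ^ (n - 1))) t := by
  have hc := (hφ.continuousOn_ray u).continuousAt (Ioi_mem_nhds ht)
  have h1 : HasDerivAt (fun s => ∫ r in t..s, φ (r • (u : RSpace n)) * r ^ (n - 1))
      (φ (t • (u : RSpace n)) * t ^ (n - 1)) t :=
    intervalIntegral.integral_hasDerivAt_right (by simp)
      ((hφ.continuousOn_ray u).stronglyMeasurableAtFilter isOpen_Ioi t ht) hc
  refine (h1.const_sub ((PhiBar φ (t, u)).toReal)).congr_of_eventuallyEq ?_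
  filter_upwards [Ioi_mem_nhds ht] with s hs
  rw [← hφ.toReal_PhiBar_sub u hs ht]
  ring

/-- A Lipschitz bound uniform in `u`, used to dominate the difference quotients of the dual volume.
-/
theorem abs_toReal_PhiBar_sub_le (hφ : Admissible φ) {a b : ℝ} (ha : 0 < a) :
    ∃ C ≥ 0, ∀ u : USphere n, ∀ s ∈ Icc a b, ∀ t ∈ Icc a b,
      |(PhiBar φ (t, u)).toReal - (PhiBar φ (s, u)).toReal| ≤ C * |t - s| := by
  have hK : IsCompact (Icc a b ×ˢ (univ : Set (USphere n))) := isCompact_Icc.prod isCompact_univ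
  obtain ⟨C, hC⟩ := hK.exists_bound_of_continuousOn
    (hφ.continuousOn_radial.mono (prod_mono (fun x hx => ha.trans_le hx.1) subset_rfl))
  refine ⟨max C 0, le_max_right _ _, fun u s hs t ht => ?_⟩
  rw [hφ.toReal_PhiBar_sub u (ha.trans_le hs.1) (ha.trans_le ht.1), abs_sub_comm]
  rw [abs_sub_comm, ← Real.norm_eq_abs (t - s), ← Real.norm_eq_abs, norm_sub_rev]
  refine intervalIntegral.norm_integral_le_of_norm_le_const fun r hr => ?_
  refine le_max_of_le_left (hC (r, u) ⟨?_, mem_univ u⟩)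
  have := uIoc_subset_uIcc hr
  exact uIcc_subset_Icc ht hs this

end Admissible

end DualOrlicz

/-! ### The Orlicz energy and existence of a minimizer -/

namespace DualOrlicz

variable {n : ℕ}

section Potential

/-- The primitive of `ψ(s) / s` vanishing at `r`. -/
noncomputable def orliczPotential (ψ : ℝ → ℝ) (r x : ℝ) : ℝ := ∫ s in r..x, ψ s / s

variable {ψ : ℝ → ℝ} {r : ℝ}

theorem continuousOn_div_id (hψ : ContinuousOn ψ (Ioi 0)) :
    ContinuousOn (fun s => ψ s / s) (Ioi 0) :=
  hψ.div continuousOn_id fun _ hs => ne_of_gt hs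

theorem intervalIntegrable_div_id (hψ : ContinuousOn ψ (Ioi 0)) {x y : ℝ} (hx : 0 < x)
    (hy : 0 < y) : IntervalIntegrable (fun s => ψ s / s) volume x y :=
  ((continuousOn_div_id hψ).mono fun _ hs => (lt_min hx hy).trans_le hs.1).intervalIntegrable

theorem hasDerivAt_orliczPotential (hψ : ContinuousOn ψ (Ioi 0)) (hr : 0 < r) {x : ℝ}
    (hx : 0 < x) : HasDerivAt (orliczPotential ψ r) (ψ x / x) x :=
  intervalIntegral.integral_hasDerivAt_right (intervalIntegrable_div_id hψ hr hx)
    ((continuousOn_div_id hψ).stronglyMeasurableAtFilter isOpen_Ioi x hx)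
    ((continuousOn_div_id hψ).continuousAt (Ioi_mem_nhds hx))

theorem continuousOn_orliczPotential (hψ : ContinuousOn ψ (Ioi 0)) (hr : 0 < r) :
    ContinuousOn (orliczPotential ψ r) (Ioi 0) := fun _ hx =>
  (hasDerivAt_orliczPotential hψ hr hx).continuousAt.continuousWithinAt

theorem orliczPotential_mono (hψ : ContinuousOn ψ (Ioi 0)) (hψpos : ∀ s, 0 < s → 0 < ψ s)
    (hr : 0 < r) {x y : ℝ} (hx : 0 < x) (hxy : x ≤ y) :
    orliczPotential ψ r x ≤ orliczPotential ψ r y := by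
  have hy := hx.trans_le hxy
  rw [orliczPotential, orliczPotential, ← intervalIntegral.integral_add_adjacent_intervals
    (intervalIntegrable_div_id hψ hr hx) (intervalIntegrable_div_id hψ hx hy)]
  have : 0 ≤ ∫ s in x..y, ψ s / s := intervalIntegral.integral_nonneg hxy fun s hs =>
    div_nonneg (hψpos s (hx.trans_le hs.1)).le (hx.trans_le hs.1).le
  linarith

/-- The base point `r` will be the lower bound for admissible functions, which makes the energy
integrand nonnegative and lets it be restricted to a cap. -/
theorem orliczPotential_nonneg (hψ : ContinuousOn ψ (Ioi 0)) (hψpos : ∀ s, 0 < s → 0 < ψ s)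
    (hr : 0 < r) {x : ℝ} (hx : r ≤ x) : 0 ≤ orliczPotential ψ r x := by
  simpa [orliczPotential] using orliczPotential_mono hψ hψpos hr hr hx

/-- A bounded primitive would make the nonnegative function `ψ(s)/s` integrable on `(1, ∞)`. -/
theorem exists_lt_orliczPotential (hψ : ContinuousOn ψ (Ioi 0)) (hψpos : ∀ s, 0 < s → 0 < ψ s)
    (hψint : ∫⁻ s in Ioi (1 : ℝ), ENNReal.ofReal (ψ s / s) = ∞) (hr : 0 < r) (C : ℝ) :
    ∃ x, r ≤ x ∧ C < orliczPotential ψ r x := by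
  by_contra! h
  have hpos : ∀ s ∈ Ioi (1 : ℝ), 0 ≤ ψ s / s := fun s hs =>
    div_nonneg (hψpos s (one_pos.trans hs)).le (one_pos.trans hs).le
  have hint : IntegrableOn (fun s => ψ s / s) (Ioi 1) := by
    refine integrableOn_Ioi_of_intervalIntegral_norm_bounded (l := atTop) (b := fun x : ℝ => x)
      (C + ∫ s in (1 : ℝ)..r, ψ s / s) 1 (fun x => ?_) tendsto_id ?_
    · rcases le_total x 1 with hx | hx
      · simp [Ioc_eq_empty (not_lt.2 hx)]
      · exact (intervalIntegrable_div_id hψ one_pos (one_pos.trans_le hx)).1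
    · filter_upwards [eventually_ge_atTop r, eventually_ge_atTop 1] with x hxr hx1
      have hx := hr.trans_le hxr
      have h1 := h x hxr
      have h2 : ∫ s in (1 : ℝ)..x, ‖ψ s / s‖ = ∫ s in (1 : ℝ)..x, ψ s / s := by
        refine intervalIntegral.integral_congr fun s hs => ?_
        rw [uIcc_of_le hx1] at hs
        have hs0 := one_pos.trans_le hs.1
        exact Real.norm_of_nonneg (div_nonneg (hψpos s hs0).le hs0.le)
      rw [h2, ← intervalIntegral.integral_add_adjacent_intervals
        (intervalIntegrable_div_id hψ one_pos hr) (intervalIntegrable_div_id hψ hr hx)]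
      rw [orliczPotential] at h1
      linarith
  have := hint.2
  rw [hasFiniteIntegral_iff_ofReal ((ae_restrict_iff' measurableSet_Ioi).2
    (Eventually.of_forall hpos)), hψint] at this
  exact lt_irrefl _ this

end Potential

/-- A measure not concentrated on a hemisphere gives uniformly positive mass to all caps of some
fixed size. -/
theorem exists_cap_bound [Nonempty (USphere n)] (μ : Measure (USphere n)) [IsFiniteMeasure μ]
    (hμ : NotConcentratedOnHemisphere μ) :
    ∃ δ > 0, ∃ m > 0, ∀ u : USphere n,
      m ≤ μ.real {v : USphere n | δ ≤ inner ℝ (v : RSpace n) (u : RSpace n)} := by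
  have hb : ∀ u v : USphere n, ‖max (inner ℝ (v : RSpace n) (u : RSpace n)) 0‖ ≤ 1 := by
    intro u v
    have h := (le_abs_self _).trans (abs_inner_sphere_le (v : RSpace n) u)
    rw [norm_coe_sphere] at h
    rw [Real.norm_of_nonneg (le_max_right _ _)]
    exact max_le h zero_le_one
  have hc : Continuous fun u : USphere n =>
      ∫ v : USphere n, max (inner ℝ (v : RSpace n) (u : RSpace n)) 0 ∂μ := by
    refine continuous_of_dominated (bound := fun _ => 1) (fun u => ?_)
      (fun u => Eventually.of_forall (hb u)) (integrable_const _)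
      (Eventually.of_forall fun v => by fun_prop)
    exact Continuous.aestronglyMeasurable (by fun_prop)
  obtain ⟨u₀, -, h₀⟩ := isCompact_univ.exists_isMinOn univ_nonempty hc.continuousOn
  set m := ∫ v : USphere n, max (inner ℝ (v : RSpace n) (u₀ : RSpace n)) 0 ∂μ with hm
  have hm0 : 0 < m := hμ u₀
  have hμ0 : 0 ≤ μ.real univ := measureReal_nonneg
  -- Here `δ` is chosen so that `δ · μ(S) ≤ m/2`: points outside the cap contribute at most half of
  -- the integral, which is at least `m`.
  refine ⟨m / (2 * (μ.real univ + 1)), by positivity, m / 2, by positivity, fun u => ?_⟩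
  set δ := m / (2 * (μ.real univ + 1)) with hδ
  set s := {v : USphere n | δ ≤ inner ℝ (v : RSpace n) (u : RSpace n)} with hs
  have hsm : MeasurableSet s :=
    measurableSet_le measurable_const (measurable_subtype_coe.inner measurable_const)
  have hδ0 : 0 < δ := by positivity
  have h1 : m ≤ ∫ v : USphere n, max (inner ℝ (v : RSpace n) (u : RSpace n)) 0 ∂μ :=
    h₀ (mem_univ u)
  have h2 : ∫ v : USphere n, max (inner ℝ (v : RSpace n) (u : RSpace n)) 0 ∂μ ≤
      ∫ v : USphere n, (δ + s.indicator (fun _ => (1 : ℝ)) v) ∂μ := by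
    refine integral_mono ?_ ((integrable_const _).add ((integrable_const _).indicator hsm))
      fun v => ?_
    · exact Integrable.of_bound (Continuous.aestronglyMeasurable (by fun_prop)) 1
        (Eventually.of_forall (hb u))
    · by_cases hv : v ∈ s
      · rw [indicator_of_mem hv]
        have := (le_abs_self _).trans (hb u v)
        exact this.trans (by linarith)
      · rw [indicator_of_notMem hv, add_zero]
        have : inner ℝ (v : RSpace n) (u : RSpace n) < δ := not_le.1 hv
        exact max_le this.le hδ0.le
  rw [integral_add (integrable_const _) ((integrable_const _).indicator hsm), integral_const,
    integral_indicator_const _ hsm, smul_eq_mul, smul_eq_mul, mul_one] at h2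
  have h3 : μ.real univ * δ ≤ m / 2 := by
    rw [hδ, mul_div_assoc', div_le_div_iff₀ (by positivity) (by norm_num)]
    nlinarith
  linarith

/-- The functional `f ↦ ∫ Ψ(f) dμ`. -/
noncomputable def orliczEnergy (ψ : ℝ → ℝ) (r : ℝ) (μ : Measure (USphere n))
    (f : USphere n → ℝ) : ℝ := ∫ v, orliczPotential ψ r (f v) ∂μ

section Energy

variable {ψ : ℝ → ℝ} {r : ℝ} {μ : Measure (USphere n)} [IsFiniteMeasure μ] {f g : USphere n → ℝ}

theorem continuous_orliczPotential_comp (hψ : ContinuousOn ψ (Ioi 0)) (hr : 0 < r)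
    (hf : PosCont f) : Continuous fun v => orliczPotential ψ r (f v) :=
  (continuousOn_orliczPotential hψ hr).comp_continuous hf.cont hf.pos

theorem integrable_of_continuous {h : USphere n → ℝ} (hh : Continuous h)
    (ν : Measure (USphere n)) [IsFiniteMeasure ν] : Integrable h ν :=
  hh.integrable_of_hasCompactSupport (HasCompactSupport.of_compactSpace h)

theorem orliczEnergy_mono (hψ : ContinuousOn ψ (Ioi 0)) (hψpos : ∀ s, 0 < s → 0 < ψ s)
    (hr : 0 < r) (hf : PosCont f) (hg : PosCont g) (hfg : ∀ v, f v ≤ g v) :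
    orliczEnergy ψ r μ f ≤ orliczEnergy ψ r μ g :=
  integral_mono (integrable_of_continuous (continuous_orliczPotential_comp hψ hr hf) μ)
    (integrable_of_continuous (continuous_orliczPotential_comp hψ hr hg) μ)
    fun v => orliczPotential_mono hψ hψpos hr (hf.pos v) (hfg v)

/-- A bound on the energy bounds the support function. -/
theorem exists_le_of_orliczEnergy_le [Nonempty (USphere n)] (hψ : ContinuousOn ψ (Ioi 0))
    (hψpos : ∀ s, 0 < s → 0 < ψ s)
    (hψint : ∫⁻ s in Ioi (1 : ℝ), ENNReal.ofReal (ψ s / s) = ∞) (hr : 0 < r)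
    (hμ : NotConcentratedOnHemisphere μ) (C : ℝ) :
    ∃ R, ∀ f : USphere n → ℝ, PosCont f → dualFn (dualFn f) = f → (∀ v, r ≤ f v) →
      orliczEnergy ψ r μ f ≤ C → ∀ v, f v ≤ R := by
  obtain ⟨δ, hδ, m, hm, hcap⟩ := exists_cap_bound μ hμ
  obtain ⟨x, hrx, hx⟩ := exists_lt_orliczPotential hψ hψpos hψint hr (C / m)
  refine ⟨x / δ, fun f hf hff hrf hE v₁ => ?_⟩
  by_contra! hlt
  -- The direction `u₁` is that of a boundary point with normal `v₁`, hence of a point of norm at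
  -- least `f v₁ > x/δ`. Testing against this point gives `f ≥ x` on the cap of size `δ` about `u₁`.
  obtain ⟨u₁, hu₁⟩ := hf.dual.exists_eq_polarFn (v₁ : RSpace n)
  have hu₁' : inner ℝ (v₁ : RSpace n) (u₁ : RSpace n) = f v₁ * dualFn f u₁ := by
    rw [hu₁, ← congrFun hff v₁]; rfl
  have h1 : f v₁ * dualFn f u₁ ≤ 1 := by
    rw [← hu₁']
    exact (le_abs_self _).trans ((abs_inner_sphere_le _ _).trans (norm_coe_sphere v₁).le)
  set s := {v : USphere n | δ ≤ inner ℝ (v : RSpace n) (u₁ : RSpace n)} with hs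
  have hsm : MeasurableSet s :=
    measurableSet_le measurable_const (measurable_subtype_coe.inner measurable_const)
  have hlow : ∀ v ∈ s, x ≤ f v := by
    intro v hv
    have hv : δ ≤ inner ℝ (v : RSpace n) (u₁ : RSpace n) := hv
    have h2 : inner ℝ (v : RSpace n) (u₁ : RSpace n) ≤ dualFn f u₁ * f v := by
      rw [real_inner_comm]; exact hf.inner_le _ v
    have h3 : x ≤ f v₁ * δ := ((div_lt_iff₀ hδ).1 hlt).le
    have h4 : f v₁ * δ ≤ f v₁ * (dualFn f u₁ * f v) :=
      mul_le_mul_of_nonneg_left (hv.trans h2) (hf.pos v₁).le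
    have h5 : f v₁ * dualFn f u₁ * f v ≤ 1 * f v :=
      mul_le_mul_of_nonneg_right h1 (hf.pos v).le
    linarith
  have h6 : ∫ v, s.indicator (fun _ => orliczPotential ψ r x) v ∂μ ≤ orliczEnergy ψ r μ f := by
    refine integral_mono ((integrable_const _).indicator hsm)
      (integrable_of_continuous (continuous_orliczPotential_comp hψ hr hf) μ) fun v => ?_
    by_cases hv : v ∈ s
    · rw [indicator_of_mem hv]
      exact orliczPotential_mono hψ hψpos hr (hr.trans_le hrx) (hlow v hv)
    · rw [indicator_of_notMem hv]
      exact orliczPotential_nonneg hψ hψpos hr (hrf v)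
  rw [integral_indicator_const _ hsm, smul_eq_mul] at h6
  have h7 : m * orliczPotential ψ r x ≤ μ.real s * orliczPotential ψ r x :=
    mul_le_mul_of_nonneg_right (hcap u₁) (orliczPotential_nonneg hψ hψpos hr hrx)
  have h8 := (div_lt_iff₀ hm).1 hx
  linarith

/-- Existence of a minimizer of the energy among bodies whose complement has `φ`-volume at most
that of the unit ball. -/
theorem exists_minimizer [Nonempty (USphere n)] {φ : RSpace n → ℝ} (hφ : Admissible φ)
    (hψ : ContinuousOn ψ (Ioi 0)) (hψpos : ∀ s, 0 < s → 0 < ψ s)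
    (hψint : ∫⁻ s in Ioi (1 : ℝ), ENNReal.ofReal (ψ s / s) = ∞) (hr : 0 < r)
    (hμ : NotConcentratedOnHemisphere μ)
    (hlow : ∀ f : USphere n → ℝ, PosCont f → dualVolume φ f ≤ dualVolume φ (fun _ => 1) →
      ∀ v, r ≤ f v) :
    ∃ f : USphere n → ℝ, PosCont f ∧ dualFn (dualFn f) = f ∧
      dualVolume φ f ≤ dualVolume φ (fun _ => 1) ∧
      ∀ g : USphere n → ℝ, PosCont g → dualVolume φ g ≤ dualVolume φ (fun _ => 1) →
        orliczEnergy ψ r μ f ≤ orliczEnergy ψ r μ g := by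
  have h1 : PosCont (fun _ : USphere n => (1 : ℝ)) := ⟨continuous_const, fun _ => one_pos⟩
  have hr1 : r ≤ 1 := hlow _ h1 le_rfl (Classical.arbitrary _)
  obtain ⟨R', hR'⟩ := exists_le_of_orliczEnergy_le hψ hψpos hψint hr hμ
    (orliczEnergy ψ r μ (fun _ : USphere n => (1 : ℝ)))
  -- The maximum with `1` puts the constant function `1` into the compact class.
  set R := max R' 1 with hR
  have hR0 : 0 < R := one_pos.trans_le (le_max_right _ _)
  -- Support functions of bodies inside the ball of radius `R` are `R`-Lipschitz. The class keeps
  -- only this consequence of convexity, which is closed under uniform limits.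
  set 𝓐 : Set (BoundedContinuousFunction (USphere n) ℝ) :=
    {f | (∀ v, f v ∈ Icc r R) ∧ LipschitzWith (Real.toNNReal R) f ∧
      dualVolume φ f ≤ dualVolume φ (fun _ => 1)} with h𝓐
  have hpos : ∀ f ∈ 𝓐, PosCont f := fun f hf => ⟨f.continuous, fun v => hr.trans_le (hf.1 v).1⟩
  have hclosed : IsClosed 𝓐 := by
    refine IsSeqClosed.isClosed fun F f hF hlim => ?_
    have hpt : ∀ v, Tendsto (fun k => F k v) atTop (𝓝 (f v)) := fun v =>
      (continuous_eval_const v).continuousAt.tendsto.comp hlim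
    have hfI : ∀ v, f v ∈ Icc r R := fun v =>
      isClosed_Icc.mem_of_tendsto (hpt v) (Eventually.of_forall fun k => (hF k).1 v)
    have hf : PosCont f := ⟨f.continuous, fun v => hr.trans_le (hfI v).1⟩
    refine ⟨hfI, ?_, ?_⟩
    · refine LipschitzWith.of_dist_le_mul fun x y => ?_
      exact le_of_tendsto ((hpt x).dist (hpt y))
        (Eventually.of_forall fun k => (hF k).2.1.dist_le_mul x y)
    · refine hφ.dualVolume_le_of_tendsto (fun k => hpos _ (hF k)) hf (fun u => ?_)
        fun k => (hF k).2.2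
      rw [tendsto_iff_dist_tendsto_zero]
      have hd : Tendsto (fun k => r⁻¹ * r⁻¹ * dist (F k) f) atTop (𝓝 0) := by
        simpa using (tendsto_iff_dist_tendsto_zero.1 hlim).const_mul (r⁻¹ * r⁻¹)
      refine squeeze_zero (fun _ => dist_nonneg) (fun k => ?_) hd
      exact (hpos _ (hF k)).abs_dualFn_sub_le hf hr (fun v => ((hF k).1 v).1) (fun v => (hfI v).1)
        (fun v => (Real.dist_eq _ _).symm.trans_le
          (BoundedContinuousFunction.dist_coe_le_dist v)) u
  have hcomp : IsCompact 𝓐 := by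
    refine BoundedContinuousFunction.arzela_ascoli₂ (Icc r R) isCompact_Icc 𝓐 hclosed
      (fun f v hf => hf.1 v) ?_
    exact (LipschitzWith.uniformEquicontinuous (fun f : 𝓐 => (f : USphere n → ℝ))
      (Real.toNNReal R) fun f => f.2.2.1).equicontinuous
  have hJ : ContinuousOn (fun f : BoundedContinuousFunction (USphere n) ℝ =>
      orliczEnergy ψ r μ f) 𝓐 := by
    refine continuousOn_of_dominated (bound := fun _ => orliczPotential ψ r R) (fun f hf => ?_)
      (fun f hf => Eventually.of_forall fun v => ?_) (integrable_const _)
      (Eventually.of_forall fun v => ?_)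
    · exact (continuous_orliczPotential_comp hψ hr (hpos f hf)).aestronglyMeasurable
    · rw [Real.norm_of_nonneg (orliczPotential_nonneg hψ hψpos hr (hf.1 v).1)]
      exact orliczPotential_mono hψ hψpos hr ((hpos f hf).pos v) (hf.1 v).2
    · exact (continuousOn_orliczPotential hψ hr).comp
        (continuous_eval_const v).continuousOn
        fun f hf => (hpos f hf).pos v
  have hone : BoundedContinuousFunction.const (USphere n) (1 : ℝ) ∈ 𝓐 :=
    ⟨fun v => ⟨hr1, le_max_right _ _⟩, LipschitzWith.const' _, le_rfl⟩
  obtain ⟨f, hf, hmin⟩ := hcomp.exists_isMinOn ⟨_, hone⟩ hJ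
  have hvol : ∀ g : USphere n → ℝ, PosCont g → dualVolume φ (dualFn (dualFn g)) = dualVolume φ g :=
    fun g hg => by rw [dualVolume, dualVolume, hg.dualFn_dualFn_dualFn]
  have hEn : ∀ g : USphere n → ℝ, PosCont g →
      orliczEnergy ψ r μ (dualFn (dualFn g)) ≤ orliczEnergy ψ r μ g :=
    fun g hg => orliczEnergy_mono hψ hψpos hr hg.dual.dual hg hg.dualFn_dualFn_le
  refine ⟨dualFn (dualFn f), (hpos f hf).dual.dual, (hpos f hf).dual.dualFn_dualFn_dualFn,
    (hvol f (hpos f hf)).trans_le hf.2.2, fun g hg hgV => (hEn f (hpos f hf)).trans ?_⟩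
  refine le_trans ?_ (hEn g hg)
  -- A competitor whose bidual has at most the energy of the unit ball has that bidual in the
  -- compact class; otherwise the unit ball itself does better.
  rcases le_or_gt (orliczEnergy ψ r μ (dualFn (dualFn g)))
    (orliczEnergy ψ r μ (fun _ : USphere n => (1 : ℝ))) with hle | hgt
  · have hgr := hlow _ hg.dual.dual ((hvol g hg).trans_le hgV)
    have hgR : ∀ v, dualFn (dualFn g) v ≤ R := fun v =>
      (hR' _ hg.dual.dual hg.dual.dualFn_dualFn_dualFn hgr hle v).trans (le_max_left _ _)
    have hlip : LipschitzWith (Real.toNNReal R) (dualFn (dualFn g)) := by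
      -- The bidual is the dual of `dualFn g`, so a lower bound `R⁻¹` on `dualFn g` makes it
      -- `R`-Lipschitz.
      have hge : ∀ v, R⁻¹ ≤ dualFn g v := fun v => by
        rw [← hg.dualFn_dualFn_dualFn]
        exact (inv_anti₀ (hg.dual.dual.pos v) (hgR v)).trans (hg.dual.dual.inv_le_dualFn v)
      simpa using hg.dual.lipschitzWith_dualFn (inv_pos.2 hR0) hge
    exact hmin (a := BoundedContinuousFunction.mkOfCompact ⟨_, hg.dual.dual.cont⟩)
      ⟨fun v => ⟨hgr v, hgR v⟩, hlip, (hvol g hg).trans_le hgV⟩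
  · exact (hmin hone).trans hgt.le

end Energy

end DualOrlicz

/-! ### The normal map and first variations -/

namespace DualOrlicz

variable {n : ℕ}

open Classical in
/-- The unique normal of the Wulff shape of `f` in direction `u` (and `u` if it is not unique). -/
noncomputable def normalMap (f : USphere n → ℝ) (u : USphere n) : USphere n :=
  if h : ∃! v, IsNormal f u v then h.choose else u

theorem isNormal_iff {f : USphere n → ℝ} {u : USphere n} (h : ∃! v, IsNormal f u v)
    (v : USphere n) : IsNormal f u v ↔ v = normalMap f u := by
  rw [normalMap, dif_pos h]
  exact ⟨fun hv => h.choose_spec.2 v hv, fun hv => hv ▸ h.choose_spec.1⟩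

/-- Approximate normals converge to the normal if the latter is unique. -/
theorem PosCont.tendsto_normal {β : Type*} {l : Filter β} {f : USphere n → ℝ} (hf : PosCont f)
    {u : USphere n} (hu : ∃! v, IsNormal f u v) {w : β → USphere n}
    (hw : Tendsto (fun i => inner ℝ (u : RSpace n) (w i : RSpace n) - dualFn f u * f (w i)) l
      (𝓝 0)) : Tendsto w l (𝓝 (normalMap f u)) := by
  -- On a compact sphere it suffices that every cluster point is a normal at `u`; there the
  -- continuous defect vanishes.
  refine isCompact_univ.tendsto_nhds_of_unique_mapClusterPt (Eventually.of_forall fun _ => mem_univ _)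
    fun v _ hv => (isNormal_iff hu v).1 ?_
  have hfc := hf.cont
  have hD : Continuous fun v : USphere n =>
      inner ℝ (u : RSpace n) (v : RSpace n) - dualFn f u * f v := by fun_prop
  have h1 := hv.continuousAt_comp hD.continuousAt
  have h2 : (inner ℝ (u : RSpace n) (v : RSpace n) - dualFn f u * f v) = 0 := by
    by_contra hne
    have h3 := (disjoint_nhds_nhds.2 hne).mono_right hw
    exact h1.neBot.ne (disjoint_iff.1 h3)
  exact sub_eq_zero.1 h2

variable [Nonempty (USphere n)] {f : USphere n → ℝ}

/-- The normal at a nearby `w` is an approximate normal at `u`, with a defect controlled by `‖u -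
w‖` and `|dualFn f u - dualFn f w|`. -/
theorem PosCont.continuousOn_normalMap (hf : PosCont f) :
    ContinuousOn (normalMap f) {u | ∃! v, IsNormal f u v} := by
  intro u hu
  refine hf.tendsto_normal hu ?_
  obtain ⟨R, hR, hfR⟩ := hf.exists_le
  have h0 : Tendsto (fun w : USphere n => ‖(u - w : RSpace n)‖ + |dualFn f u - dualFn f w| * R)
      (𝓝[{u | ∃! v, IsNormal f u v}] u) (𝓝 0) := by
    have hc : Continuous fun w : USphere n =>
        ‖(u - w : RSpace n)‖ + |dualFn f u - dualFn f w| * R := by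
      have := hf.dual.cont
      fun_prop
    have h := (hc.tendsto u).mono_left
      (nhdsWithin_le_nhds (s := {u : USphere n | ∃! v, IsNormal f u v}))
    simpa using h
  refine squeeze_zero_norm' ?_ h0
  filter_upwards [self_mem_nhdsWithin] with w hw
  have h1 : inner ℝ (w : RSpace n) (normalMap f w : RSpace n) = dualFn f w * f (normalMap f w) :=
    (isNormal_iff hw _).2 rfl
  have h2 : inner ℝ (u : RSpace n) (normalMap f w : RSpace n) - dualFn f u * f (normalMap f w) =
      inner ℝ (u - w : RSpace n) (normalMap f w : RSpace n) -
        (dualFn f u - dualFn f w) * f (normalMap f w) := by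
    rw [inner_sub_left, h1]; ring
  rw [h2]
  refine (norm_sub_le _ _).trans (add_le_add ?_ ?_)
  · rw [Real.norm_eq_abs]; exact abs_inner_sphere_le _ _
  · rw [norm_mul, Real.norm_eq_abs, Real.norm_of_nonneg (hf.pos _).le]
    exact mul_le_mul_of_nonneg_left (hfR _) (abs_nonneg _)

theorem PosCont.aemeasurable_normalMap (hf : PosCont f) :
    AEMeasurable (normalMap f) (sphereMeasure n) := by
  obtain ⟨s, hs, hsm, hs0⟩ := exists_measurable_superset_of_null
    (ae_iff.1 (ae_existsUnique_isNormal hf))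
  have h1 : AEMeasurable (normalMap f) ((sphereMeasure n).restrict sᶜ) :=
    (hf.continuousOn_normalMap.mono
      (compl_subset_comm.1 hs)).aemeasurable hsm.compl
  rwa [Measure.restrict_eq_self_of_ae_mem] at h1
  exact compl_mem_ae_iff.2 hs0

/-- The logarithmic perturbation `f e^{tg}`. -/
noncomputable def perturb (f g : USphere n → ℝ) (t : ℝ) : USphere n → ℝ :=
  fun v => f v * Real.exp (t * g v)

variable {g : USphere n → ℝ}

omit [Nonempty (USphere n)] in
theorem PosCont.perturb (hf : PosCont f) (hg : Continuous g) (t : ℝ) : PosCont (perturb f g t) where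
  cont := hf.cont.mul (Real.continuous_exp.comp (continuous_const.mul hg))
  pos v := mul_pos (hf.pos v) (Real.exp_pos _)

omit [Nonempty (USphere n)] in
theorem perturb_zero (f g : USphere n → ℝ) : perturb f g 0 = f := by
  funext v; simp [perturb]

theorem PosCont.dualFn_perturb_le (hf : PosCont f) (hg : Continuous g) {G : ℝ}
    (hG : ∀ v, |g v| ≤ G) {t : ℝ} (ht : 0 ≤ t) (u : USphere n) :
    dualFn (DualOrlicz.perturb f g t) u ≤ dualFn f u * Real.exp (t * G) := by
  refine (hf.perturb hg t).polarFn_le_iff.2 fun v => (hf.inner_le _ v).trans ?_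
  have h1 : 1 ≤ Real.exp (t * G) * Real.exp (t * g v) := by
    rw [← Real.exp_add]
    refine Real.one_le_exp ?_
    have := mul_le_mul_of_nonneg_left (neg_le_of_abs_le (hG v)) ht
    linarith
  have h2 : 0 < polarFn f (u : RSpace n) * f v := mul_pos (hf.dual.pos u) (hf.pos v)
  calc polarFn f (u : RSpace n) * f v ≤
      polarFn f (u : RSpace n) * f v * (Real.exp (t * G) * Real.exp (t * g v)) :=
        le_mul_of_one_le_right h2.le h1
    _ = _ := by rw [dualFn, DualOrlicz.perturb]; ring

theorem PosCont.le_dualFn_perturb (hf : PosCont f) (hg : Continuous g) {G : ℝ}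
    (hG : ∀ v, |g v| ≤ G) {t : ℝ} (ht : 0 ≤ t) (u : USphere n) :
    dualFn f u * Real.exp (-(t * G)) ≤ dualFn (DualOrlicz.perturb f g t) u := by
  obtain ⟨v, hv⟩ := hf.exists_eq_polarFn (u : RSpace n)
  have h1 := (hf.perturb hg t).inner_le (u : RSpace n) v
  rw [hv, DualOrlicz.perturb, mul_comm (f v), ← mul_assoc] at h1
  have h2 := le_of_mul_le_mul_right h1 (hf.pos v)
  have h3 : Real.exp (t * g v) ≤ Real.exp (t * G) :=
    Real.exp_le_exp.2 (mul_le_mul_of_nonneg_left ((le_abs_self _).trans (hG v)) ht)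
  rw [Real.exp_neg, ← div_eq_mul_inv, div_le_iff₀ (Real.exp_pos _)]
  exact h2.trans (mul_le_mul_of_nonneg_left h3 ((hf.perturb hg t).dual.pos u).le)

/-- The one-sided derivative of the logarithm of the gauge under logarithmic perturbations. -/
theorem PosCont.hasDerivWithinAt_log_dualFn (hf : PosCont f) (hg : Continuous g) {u : USphere n}
    (hu : ∃! v, IsNormal f u v) :
    HasDerivWithinAt (fun t => Real.log (dualFn (DualOrlicz.perturb f g t) u))
      (-g (normalMap f u)) (Ioi 0) 0 := by
  set v₀ := normalMap f u with hv₀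
  have hn₀ : inner ℝ (u : RSpace n) (v₀ : RSpace n) = dualFn f u * f v₀ := (isNormal_iff hu _).2 rfl
  have hp0 := hf.dual.pos u
  -- An envelope argument. The fixed normal `v₀` tested in the perturbed problem bounds the gauge
  -- below; the perturbed maximizer `w t` tested in the original problem bounds it above.
  choose w hw using fun t => (hf.perturb hg t).exists_eq_polarFn (u : RSpace n)
  have hw' : ∀ t, inner ℝ (u : RSpace n) (w t : RSpace n) =
      dualFn (DualOrlicz.perturb f g t) u * (f (w t) * Real.exp (t * g (w t))) := hw
  have hlow : ∀ t, dualFn f u ≤ dualFn (DualOrlicz.perturb f g t) u * Real.exp (t * g v₀) := by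
    intro t
    have h1 := (hf.perturb hg t).inner_le (u : RSpace n) v₀
    rw [hn₀, DualOrlicz.perturb, mul_comm (f v₀), ← mul_assoc] at h1
    exact le_of_mul_le_mul_right h1 (hf.pos v₀)
  have hup : ∀ t, dualFn (DualOrlicz.perturb f g t) u * Real.exp (t * g (w t)) ≤ dualFn f u := by
    intro t
    have h1 := hf.inner_le (u : RSpace n) (w t)
    rw [hw' t, mul_comm (f (w t)), ← mul_assoc] at h1
    exact le_of_mul_le_mul_right h1 (hf.pos (w t))
  obtain ⟨R, hR, hfR⟩ := hf.exists_le
  obtain ⟨G, hG⟩ := isCompact_univ.exists_bound_of_continuousOn hg.continuousOn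
  have hG : ∀ v, |g v| ≤ G := fun v => hG v (mem_univ v)
  have hwlim : Tendsto w (𝓝[>] 0) (𝓝 v₀) := by
    refine hf.tendsto_normal hu ?_
    -- The exponent `2tG` collects one `tG` from `g v₀` and one from `g (w t)`.
    have h0 : Tendsto (fun t : ℝ => dualFn f u * (1 - Real.exp (-(2 * t * G))) * R) (𝓝[>] 0)
        (𝓝 0) := by
      have hc : Continuous fun t : ℝ => dualFn f u * (1 - Real.exp (-(2 * t * G))) * R := by
        fun_prop
      have h := (hc.tendsto 0).mono_left (nhdsWithin_le_nhds (s := Ioi (0 : ℝ)))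
      simpa using h
    refine squeeze_zero_norm' ?_ h0
    filter_upwards [self_mem_nhdsWithin] with t ht
    have ht : 0 < t := ht
    have h1 : inner ℝ (u : RSpace n) (w t : RSpace n) - dualFn f u * f (w t) =
        -((dualFn f u - dualFn (DualOrlicz.perturb f g t) u * Real.exp (t * g (w t))) * f (w t)) := by
      rw [hw' t]; ring
    have h2 := hup t
    have h3 : dualFn f u * Real.exp (-(2 * t * G)) ≤
        dualFn (DualOrlicz.perturb f g t) u * Real.exp (t * g (w t)) := by
      calc dualFn f u * Real.exp (-(2 * t * G))
          ≤ dualFn (DualOrlicz.perturb f g t) u * Real.exp (t * g v₀) * Real.exp (-(2 * t * G)) :=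
            mul_le_mul_of_nonneg_right (hlow t) (Real.exp_pos _).le
        _ = dualFn (DualOrlicz.perturb f g t) u * Real.exp (t * g v₀ - 2 * t * G) := by
            rw [mul_assoc, ← Real.exp_add, sub_eq_add_neg]
        _ ≤ _ := by
            refine mul_le_mul_of_nonneg_left (Real.exp_le_exp.2 ?_)
              ((hf.perturb hg t).dual.pos u).le
            have h4 := mul_le_mul_of_nonneg_left (neg_le_of_abs_le (hG (w t))) ht.le
            have h5 := mul_le_mul_of_nonneg_left (le_of_abs_le (hG v₀)) ht.le
            linarith
    rw [h1, norm_neg, norm_mul, Real.norm_of_nonneg (hf.pos _).le,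
      Real.norm_of_nonneg (by linarith)]
    have h6 : Real.exp (-(2 * t * G)) ≤ 1 := by
      refine Real.exp_le_one_iff.2 ?_
      have : 0 ≤ G := (abs_nonneg _).trans (hG v₀)
      have := mul_nonneg ht.le this
      linarith
    exact mul_le_mul (by linarith) (hfR _) (hf.pos _).le (mul_nonneg hp0.le (by linarith))
  rw [hasDerivWithinAt_iff_tendsto_slope' (by simp)]
  have hglim : Tendsto (fun t => -g (w t)) (𝓝[>] 0) (𝓝 (-g v₀)) :=
    ((hg.tendsto v₀).comp hwlim).neg
  -- The slope lies between `-g v₀` and `-g (w t)`, and `w t → v₀`.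
  refine tendsto_of_tendsto_of_tendsto_of_le_of_le' tendsto_const_nhds hglim ?_ ?_
  · filter_upwards [self_mem_nhdsWithin] with t ht
    have ht : 0 < t := ht
    have h1 := Real.log_le_log hp0 (hlow t)
    rw [Real.log_mul ((hf.perturb hg t).dual.pos u).ne' (Real.exp_pos _).ne', Real.log_exp] at h1
    rw [slope_def_field, perturb_zero, sub_zero, le_div_iff₀ ht]
    linarith
  · filter_upwards [self_mem_nhdsWithin] with t ht
    have ht : 0 < t := ht
    have hpt := (hf.perturb hg t).dual.pos u
    have h1 := Real.log_le_log (mul_pos hpt (Real.exp_pos _)) (hup t)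
    rw [Real.log_mul hpt.ne' (Real.exp_pos _).ne', Real.log_exp] at h1
    rw [slope_def_field, perturb_zero, sub_zero, div_le_iff₀ ht]
    linarith

/-- The density `φ(ρ(u) u) ρ(u)ⁿ` of the dual curvature measure, `ρ` being the radial function of
the Wulff shape of `f`. -/
noncomputable def radialDensity (φ : RSpace n → ℝ) (f : USphere n → ℝ)
    (u : USphere n) : ℝ :=
  φ ((dualFn f u)⁻¹ • (u : RSpace n)) * (dualFn f u)⁻¹ ^ n

namespace Admissible

variable {φ : RSpace n → ℝ}

theorem posCont_radialDensity (hφ : Admissible φ) (hf : PosCont f) :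
    PosCont (radialDensity φ f) where
  cont := by
    have hc := hf.dual.inv.cont
    refine Continuous.mul ?_ (hc.pow n)
    exact hφ.cont.comp_continuous (hc.smul continuous_subtype_val) fun u =>
      smul_sphere_ne_zero (hf.dual.inv.pos u).ne' u
  pos u := mul_pos (hφ.pos _ (smul_sphere_ne_zero (hf.dual.inv.pos u).ne' u))
    (pow_pos (hf.dual.inv.pos u) n)

omit [Nonempty (USphere n)] in
theorem continuous_toReal_PhiBar_comp (hφ : Admissible φ) {ρ : USphere n → ℝ} (hρ : PosCont ρ) :
    Continuous fun u => (PhiBar φ (ρ u, u)).toReal := by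
  refine continuous_iff_continuousAt.2 fun u => ?_
  exact (ENNReal.tendsto_toReal (hφ.finite _ (hρ.pos u) u)).comp
    ((hφ.continuous_PhiBar_comp hρ).tendsto u)

theorem toReal_dualVolume (hφ : Admissible φ) (hf : PosCont f) :
    (dualVolume φ f).toReal =
      ∫ u, (PhiBar φ ((dualFn f u)⁻¹, u)).toReal ∂(sphereMeasure n) := by
  rw [integral_toReal (hφ.continuous_PhiBar_comp hf.dual.inv).measurable.aemeasurable
    (Eventually.of_forall fun u => (hφ.finite _ (hf.dual.inv.pos u) u).lt_top), dualVolume]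

theorem hasDerivWithinAt_toReal_PhiBar_perturb (hφ : Admissible φ) (hn : 1 ≤ n) (hf : PosCont f)
    (hg : Continuous g) {u : USphere n} (hu : ∃! v, IsNormal f u v) :
    HasDerivWithinAt (fun t => (PhiBar φ ((dualFn (perturb f g t) u)⁻¹, u)).toReal)
      (-(radialDensity φ f u * g (normalMap f u))) (Ioi 0) 0 := by
  have h1 := (hf.hasDerivWithinAt_log_dualFn hg hu).neg.exp
  have h2 : ∀ t, Real.exp (-Real.log (dualFn (perturb f g t) u)) =
      (dualFn (perturb f g t) u)⁻¹ := fun t => by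
    rw [Real.exp_neg, Real.exp_log ((hf.perturb hg t).dual.pos u)]
  simp only [Pi.neg_apply, h2, neg_neg] at h1
  rw [perturb_zero] at h1
  have h3 : HasDerivAt (fun s => (PhiBar φ (s, u)).toReal)
      (-(φ ((dualFn f u)⁻¹ • (u : RSpace n)) * (dualFn f u)⁻¹ ^ (n - 1)))
      ((dualFn (perturb f g 0) u)⁻¹) := by
    rw [perturb_zero]
    exact hφ.hasDerivAt_toReal_PhiBar u (hf.dual.inv.pos u)
  refine (h3.comp_hasDerivWithinAt (0 : ℝ) h1).congr_deriv ?_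
  -- Differentiating `ρ = exp(-log (dualFn f u))` contributes a further factor `ρ`, which raises
  -- `ρ^(n-1)` to `ρ^n`.
  rw [radialDensity, ← pow_sub_one_mul (by omega : n ≠ 0)]
  ring

/-- The one-sided derivative of the dual volume under logarithmic perturbations. -/
theorem tendsto_slope_dualVolume (hφ : Admissible φ) (hn : 1 ≤ n) (hf : PosCont f)
    (hg : Continuous g) :
    Tendsto (fun t => t⁻¹ * ((dualVolume φ (perturb f g t)).toReal - (dualVolume φ f).toReal))
      (𝓝[>] 0) (𝓝 (-∫ u, radialDensity φ f u * g (normalMap f u) ∂(sphereMeasure n))) := by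
  obtain ⟨G, hG⟩ := isCompact_univ.exists_bound_of_continuousOn hg.continuousOn
  have hG : ∀ v, |g v| ≤ G := fun v => hG v (mem_univ v)
  have hG0 : 0 ≤ G := (abs_nonneg _).trans (hG (Classical.arbitrary _))
  obtain ⟨a, ha, haf⟩ := hf.dual.inv.exists_pos_le
  obtain ⟨b, hb, hbf⟩ := hf.dual.inv.exists_le
  have ha' : 0 < a * Real.exp (-G) := mul_pos ha (Real.exp_pos _)
  obtain ⟨C, hC0, hC⟩ := hφ.abs_toReal_PhiBar_sub_le (b := b * Real.exp G) ha'
  have hcont : ∀ t, Continuous fun u =>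
      (PhiBar φ ((dualFn (perturb f g t) u)⁻¹, u)).toReal := fun t =>
    hφ.continuous_toReal_PhiBar_comp (hf.perturb hg t).dual.inv
  have hcont0 : Continuous fun u => (PhiBar φ ((dualFn f u)⁻¹, u)).toReal :=
    hφ.continuous_toReal_PhiBar_comp hf.dual.inv
  rw [← integral_neg]
  have hEq : ∀ t, t⁻¹ * ((dualVolume φ (perturb f g t)).toReal - (dualVolume φ f).toReal) =
      ∫ u, t⁻¹ * ((PhiBar φ ((dualFn (perturb f g t) u)⁻¹, u)).toReal -
        (PhiBar φ ((dualFn f u)⁻¹, u)).toReal) ∂(sphereMeasure n) := fun t => by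
    rw [integral_const_mul, integral_sub (integrable_of_continuous (hcont t) _)
      (integrable_of_continuous hcont0 _), hφ.toReal_dualVolume (hf.perturb hg t),
      hφ.toReal_dualVolume hf]
  simp only [hEq]
  refine tendsto_integral_filter_of_dominated_convergence (fun _ => C * (b * (G * Real.exp G)))
    (Eventually.of_forall fun t => ?_) ?_ (integrable_const _) ?_
  · exact (continuous_const.mul ((hcont t).sub hcont0)).aestronglyMeasurable
  -- For `0 < t < 1` both radii lie in `[a e^{-G}, b e^G]`, where the Lipschitz bound applies, and
  -- they differ by at most `t b G e^G`.
  · filter_upwards [Ioo_mem_nhdsGT (zero_lt_one (α := ℝ))] with t ht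
    refine Eventually.of_forall fun u => ?_
    have ht0 := ht.1
    have htG : t * G ≤ G := mul_le_of_le_one_left hG0 ht.2.le
    have hp := hf.dual.pos u
    have hpt := (hf.perturb hg t).dual.pos u
    have h1 : (dualFn (perturb f g t) u)⁻¹ ≤ (dualFn f u)⁻¹ * Real.exp (t * G) := by
      have h := inv_anti₀ (mul_pos hp (Real.exp_pos _)) (hf.le_dualFn_perturb hg hG ht0.le u)
      rwa [mul_inv, Real.exp_neg, inv_inv] at h
    have h2 : (dualFn f u)⁻¹ * Real.exp (-(t * G)) ≤ (dualFn (perturb f g t) u)⁻¹ := by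
      have h := inv_anti₀ hpt (hf.dualFn_perturb_le hg hG ht0.le u)
      rwa [mul_inv, ← Real.exp_neg] at h
    set ρ := (dualFn f u)⁻¹ with hρ
    set ρt := (dualFn (perturb f g t) u)⁻¹ with hρt
    have hρ0 : 0 < ρ := inv_pos.2 hp
    have hmem : ρ ∈ Icc (a * Real.exp (-G)) (b * Real.exp G) := by
      constructor
      · exact (mul_le_of_le_one_right ha.le (Real.exp_le_one_iff.2 (by linarith))).trans (haf u)
      · exact (hbf u).trans (le_mul_of_one_le_right hb.le (Real.one_le_exp hG0))
    have hmemt : ρt ∈ Icc (a * Real.exp (-G)) (b * Real.exp G) := by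
      constructor
      · exact (mul_le_mul (haf u) (Real.exp_le_exp.2 (by linarith)) (Real.exp_pos _).le
          hρ0.le).trans h2
      · exact h1.trans (mul_le_mul (hbf u) (Real.exp_le_exp.2 htG) (Real.exp_pos _).le hb.le)
    have h3 := hC u ρ hmem ρt hmemt
    have hexp : Real.exp (t * G) - 1 ≤ t * G * Real.exp (t * G) := by
      have h4 := mul_le_mul_of_nonneg_right (Real.add_one_le_exp (-(t * G)))
        (Real.exp_pos (t * G)).le
      rw [← Real.exp_add, neg_add_cancel, Real.exp_zero] at h4
      linarith
    have hexp' : 1 - Real.exp (-(t * G)) ≤ t * G * Real.exp (t * G) := by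
      have h4 := Real.add_one_le_exp (-(t * G))
      have h5 : t * G ≤ t * G * Real.exp (t * G) :=
        le_mul_of_one_le_right (by positivity) (Real.one_le_exp (by positivity))
      linarith
    have h6 : t * G * Real.exp (t * G) ≤ t * (G * Real.exp G) := by
      rw [← mul_assoc]
      exact mul_le_mul_of_nonneg_left (Real.exp_le_exp.2 htG) (by positivity)
    have h7 : |ρt - ρ| ≤ b * (t * (G * Real.exp G)) := by
      refine (abs_le.2 ⟨?_, ?_⟩ : |ρt - ρ| ≤ ρ * (t * (G * Real.exp G))).trans
        (mul_le_mul_of_nonneg_right (hbf u) (by positivity))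
      · have := mul_le_mul_of_nonneg_left (hexp'.trans h6) hρ0.le
        linarith
      · have := mul_le_mul_of_nonneg_left (hexp.trans h6) hρ0.le
        linarith
    rw [norm_mul, norm_inv, Real.norm_of_nonneg ht0.le, Real.norm_eq_abs, inv_mul_le_iff₀ ht0]
    calc _ ≤ C * |ρt - ρ| := h3
      _ ≤ C * (b * (t * (G * Real.exp G))) := mul_le_mul_of_nonneg_left h7 hC0
      _ = _ := by ring
  · filter_upwards [ae_existsUnique_isNormal hf] with u hu
    have h := hφ.hasDerivWithinAt_toReal_PhiBar_perturb hn hf hg hu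
    rw [hasDerivWithinAt_iff_tendsto_slope' (by simp)] at h
    refine h.congr fun t => ?_
    rw [slope_def_field, perturb_zero, sub_zero, div_eq_inv_mul]

end Admissible

/-- The weight `1/s` in the potential cancels the factor `f e^{tg}` produced by a logarithmic
perturbation, leaving `ψ(f e^{tg}) g`. -/
theorem hasDerivAt_orliczEnergy_perturb {ψ : ℝ → ℝ} (hψ : ContinuousOn ψ (Ioi 0)) {r : ℝ}
    (hr : 0 < r) {μ : Measure (USphere n)} [IsFiniteMeasure μ] (hf : PosCont f)
    (hg : Continuous g) :
    HasDerivAt (fun t => orliczEnergy ψ r μ (perturb f g t)) (∫ v, ψ (f v) * g v ∂μ) 0 := by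
  obtain ⟨G, hG⟩ := isCompact_univ.exists_bound_of_continuousOn hg.continuousOn
  have hG : ∀ v, |g v| ≤ G := fun v => hG v (mem_univ v)
  have hG0 : 0 ≤ G := (abs_nonneg _).trans (hG (Classical.arbitrary _))
  obtain ⟨a, ha, haf⟩ := hf.exists_pos_le
  obtain ⟨b, hb, hbf⟩ := hf.exists_le
  have ha' : 0 < a * Real.exp (-G) := mul_pos ha (Real.exp_pos _)
  obtain ⟨C, hC⟩ := (isCompact_Icc (a := a * Real.exp (-G)) (b := b * Real.exp G)
    ).exists_bound_of_continuousOn (hψ.mono fun x hx => ha'.trans_le hx.1)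
  have hmem : ∀ t ∈ Metric.ball (0 : ℝ) 1, ∀ v, perturb f g t v ∈
      Icc (a * Real.exp (-G)) (b * Real.exp G) := by
    intro t ht v
    have ht : |t| < 1 := by simpa using ht
    have h1 : |t * g v| ≤ G := by
      rw [abs_mul]
      exact (mul_le_mul ht.le (hG v) (abs_nonneg _) zero_le_one).trans_eq (one_mul _)
    have h2 := abs_le.1 h1
    exact ⟨mul_le_mul (haf v) (Real.exp_le_exp.2 h2.1) (Real.exp_pos _).le (hf.pos v).le,
      mul_le_mul (hbf v) (Real.exp_le_exp.2 h2.2) (Real.exp_pos _).le hb.le⟩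
  have h := hasDerivAt_integral_of_dominated_loc_of_deriv_le (μ := μ) (𝕜 := ℝ) (x₀ := (0 : ℝ))
    (F := fun t v => orliczPotential ψ r (perturb f g t v))
    (F' := fun t v => ψ (perturb f g t v) * g v) (bound := fun _ => C * G)
    (Metric.ball_mem_nhds 0 one_pos)
    (Eventually.of_forall fun t =>
      (continuous_orliczPotential_comp hψ hr (hf.perturb hg t)).aestronglyMeasurable)
    (integrable_of_continuous (continuous_orliczPotential_comp hψ hr (hf.perturb hg 0)) μ)
    (((hψ.comp_continuous (hf.perturb hg 0).cont (hf.perturb hg 0).pos).mul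
      hg).aestronglyMeasurable)
    (Eventually.of_forall fun v t ht => ?_) (integrable_const _)
    (Eventually.of_forall fun v t ht => ?_)
  · have := h.2
    simp only [perturb_zero] at this
    exact this
  · rw [norm_mul]
    have h1 := hC _ (hmem t ht v)
    exact mul_le_mul h1 (hG v) (norm_nonneg _) ((norm_nonneg _).trans h1)
  · have hp := (hf.perturb hg t).pos v
    have h1 : HasDerivAt (fun t => perturb f g t v) (perturb f g t v * g v) t := by
      have h2 := (((hasDerivAt_id t).mul_const (g v)).exp).const_mul (f v)
      refine h2.congr_deriv ?_
      simp only [perturb, id]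
      ring
    refine ((hasDerivAt_orliczPotential hψ hr hp).comp t h1).congr_deriv ?_
    field_simp

/-- The first order condition at a minimizer of the energy. -/
theorem integral_nonneg_of_minimizer {φ : RSpace n → ℝ} (hφ : Admissible φ) (hn : 1 ≤ n)
    {ψ : ℝ → ℝ} (hψ : ContinuousOn ψ (Ioi 0)) {r : ℝ} (hr : 0 < r) {μ : Measure (USphere n)}
    [IsFiniteMeasure μ] (hf : PosCont f) {M : ℝ≥0∞} (hM : dualVolume φ f ≤ M)
    (hmin : ∀ g : USphere n → ℝ, PosCont g → dualVolume φ g ≤ M →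
      orliczEnergy ψ r μ f ≤ orliczEnergy ψ r μ g) (hg : Continuous g)
    (hpos : 0 < ∫ u, radialDensity φ f u * g (normalMap f u) ∂(sphereMeasure n)) :
    0 ≤ ∫ v, ψ (f v) * g v ∂μ := by
  -- The outer volume has negative right derivative, so `f e^{tg}` satisfies the constraint for
  -- small `t > 0`, and minimality makes the energy slopes nonnegative.
  have h1 := (hφ.tendsto_slope_dualVolume hn hf hg).eventually_lt_const (neg_lt_zero.2 hpos)
  have h2 := hasDerivAt_orliczEnergy_perturb hψ hr (μ := μ) hf hg
  have h3 := (hasDerivWithinAt_iff_tendsto_slope' (by simp)).1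
    (h2.hasDerivWithinAt (s := Ioi 0))
  refine ge_of_tendsto h3 ?_
  filter_upwards [h1, self_mem_nhdsWithin] with t ht1 ht
  have ht : 0 < t := ht
  rw [slope_def_field, perturb_zero, sub_zero]
  refine div_nonneg (sub_nonneg.2 (hmin _ (hf.perturb hg t) (le_trans ?_ hM))) ht.le
  have h4 : (dualVolume φ (perturb f g t)).toReal - (dualVolume φ f).toReal < 0 :=
    (mul_neg_iff.1 ht1).elim (fun h => h.2) fun h => absurd h.1 (not_lt.2 (inv_pos.2 ht).le)
  exact (ENNReal.toReal_le_toReal (hφ.dualVolume_ne_top (hf.perturb hg t))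
    (hφ.dualVolume_ne_top hf)).1 (sub_neg.1 h4).le

end DualOrlicz

/-! ### Wulff shapes as convex bodies and their curvature measure -/

namespace DualOrlicz

variable {n : ℕ}

/-- The Wulff shape of `f`. -/
def wulffShape (f : USphere n → ℝ) : Set (RSpace n) :=
  {x | ∀ v : USphere n, inner ℝ x (v : RSpace n) ≤ f v}

variable {f : USphere n → ℝ}

theorem norm_le_of_mem_wulffShape {R : ℝ} (hR : 0 ≤ R) (hfR : ∀ v, f v ≤ R) {x : RSpace n}
    (hx : x ∈ wulffShape f) : ‖x‖ ≤ R := by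
  rcases eq_or_ne x 0 with rfl | hx0
  · simpa using hR
  · have hx' : ‖x‖ ≠ 0 := norm_ne_zero_iff.2 hx0
    have h := (hx ⟨‖x‖⁻¹ • x, by simp [norm_smul, hx']⟩).trans (hfR _)
    rwa [inner_smul_right, real_inner_self_eq_norm_mul_norm, inv_mul_cancel_left₀ hx'] at h

theorem isClosed_wulffShape (f : USphere n → ℝ) : IsClosed (wulffShape f) := by
  have : wulffShape f = ⋂ v : USphere n, {x | inner ℝ x (v : RSpace n) ≤ f v} := by
    ext x; simp [wulffShape]
  rw [this]
  exact isClosed_iInter fun v => isClosed_le (by fun_prop) continuous_const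

variable [Nonempty (USphere n)]

/-- The Wulff shape of a positive continuous function as a convex body. -/
def wulffBody (hf : PosCont f) : ConvexBody (RSpace n) where
  carrier := wulffShape f
  convex' := by
    intro x hx y hy a b ha hb hab v
    rw [inner_add_left, real_inner_smul_left, real_inner_smul_left]
    have h1 := mul_le_mul_of_nonneg_left (hx v) ha
    have h2 := mul_le_mul_of_nonneg_left (hy v) hb
    have h3 : a * f v + b * f v = f v := by rw [← add_mul, hab, one_mul]
    linarith
  isCompact' := by
    obtain ⟨R, hR, hfR⟩ := hf.exists_le
    refine Metric.isCompact_of_isClosed_isBounded (isClosed_wulffShape f)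
      (isBounded_iff_forall_norm_le.2 ⟨R, fun x hx => norm_le_of_mem_wulffShape hR.le hfR hx⟩)
  nonempty' := ⟨0, fun v => by simpa using (hf.pos v).le⟩

namespace PosCont

theorem mem_wulffShape_iff (hf : PosCont f) {x : RSpace n} :
    x ∈ wulffShape f ↔ polarFn f x ≤ 1 := by
  simp only [hf.polarFn_le_iff, one_mul, wulffShape, mem_ofPred_eq]

theorem zero_mem_interior_wulffShape (hf : PosCont f) : (0 : RSpace n) ∈ interior (wulffShape f) := by
  obtain ⟨r, hr, hrf⟩ := hf.exists_pos_le
  refine mem_interior.2 ⟨Metric.ball 0 r, fun x hx v => ?_, Metric.isOpen_ball,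
    Metric.mem_ball_self hr⟩
  have hx : ‖x‖ < r := by simpa using hx
  exact ((le_abs_self _).trans (abs_inner_sphere_le x v)).trans (hx.le.trans (hrf v))

theorem smul_mem_wulffShape_iff (hf : PosCont f) {s : ℝ} (hs : 0 < s) (u : USphere n) :
    s • (u : RSpace n) ∈ wulffShape f ↔ s ≤ (dualFn f u)⁻¹ := by
  rw [hf.mem_wulffShape_iff, polarFn_smul f hs.le, ← one_div]
  exact (le_div_iff₀ (hf.dual.pos u)).symm

theorem radialFn_wulffShape (hf : PosCont f) (u : USphere n) :
    radialFn (wulffShape f) u = (dualFn f u)⁻¹ := by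
  have h : {s : ℝ | 0 < s ∧ s • (u : RSpace n) ∈ wulffShape f} = Ioc 0 (dualFn f u)⁻¹ := by
    ext s
    exact and_congr_right fun hs => hf.smul_mem_wulffShape_iff hs u
  rw [radialFn, h, csSup_Ioc (inv_pos.2 (hf.dual.pos u))]

/-- The maximum of `⟨·, v⟩` is attained at the boundary point in the direction where the supremum
defining the bidual at `v` is attained. Without `hff` the value would be the bidual. -/
theorem supportFn_wulffShape (hf : PosCont f) (hff : dualFn (dualFn f) = f) (v : USphere n) :
    supportFn (wulffShape f) v = f v := by
  obtain ⟨u, hu⟩ := hf.dual.exists_eq_polarFn (v : RSpace n)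
  have hu : inner ℝ (v : RSpace n) (u : RSpace n) = f v * dualFn f u := by
    rw [hu, ← congrFun hff v]; rfl
  have hu0 := hf.dual.pos u
  refine IsGreatest.csSup_eq ⟨⟨(dualFn f u)⁻¹ • (u : RSpace n),
    (hf.smul_mem_wulffShape_iff (inv_pos.2 hu0) u).2 le_rfl, ?_⟩, ?_⟩
  · simp only [inner_smul_right, hu]
    field_simp
  · rintro _ ⟨x, hx, rfl⟩
    simp only [real_inner_comm]
    exact hx v

theorem mem_supportingHyperplane_iff (hf : PosCont f) (hff : dualFn (dualFn f) = f)
    (u v : USphere n) :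
    radialFn (wulffShape f) u • (u : RSpace n) ∈ supportingHyperplane (wulffShape f) v ↔
      IsNormal f u v := by
  have hu0 := hf.dual.pos u
  simp only [supportingHyperplane, mem_ofPred_eq, hf.radialFn_wulffShape,
    hf.supportFn_wulffShape hff, real_inner_smul_left, IsNormal]
  rw [inv_mul_eq_iff_eq_mul₀ hu0.ne']

theorem mem_radialGaussImage_iff (hf : PosCont f) (hff : dualFn (dualFn f) = f)
    (u v : USphere n) : v ∈ radialGaussImage (wulffShape f) {u} ↔ IsNormal f u v := by
  rw [← hf.mem_supportingHyperplane_iff hff]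
  simp [radialGaussImage]

/-- Equality holds in every direction, since both maps default to `u` when the normal is not unique.
-/
theorem radialGaussMap_wulffShape (hf : PosCont f) (hff : dualFn (dualFn f) = f)
    (u : USphere n) : radialGaussMap (wulffShape f) u = normalMap f u := by
  have hiff : (∃! v, v ∈ radialGaussImage (wulffShape f) {u}) ↔ ∃! v, IsNormal f u v :=
    existsUnique_congr (hf.mem_radialGaussImage_iff hff u)
  by_cases h : ∃! v, IsNormal f u v
  · rw [radialGaussMap, dif_pos (hiff.2 h), ← isNormal_iff h, ← hf.mem_radialGaussImage_iff hff]
    exact (hiff.2 h).choose_spec.1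
  · rw [radialGaussMap, normalMap, dif_neg h, dif_neg (mt hiff.1 h)]

theorem mem_reverseRadialGaussImage_iff (hf : PosCont f) (hff : dualFn (dualFn f) = f)
    (A : Set (USphere n)) (u : USphere n) :
    u ∈ reverseRadialGaussImage (wulffShape f) A ↔ ∃ v ∈ A, IsNormal f u v := by
  have hu0 := hf.dual.pos u
  refine exists_congr fun v => and_congr_right fun _ => ?_
  constructor
  · rintro ⟨x, ⟨hxK, hxH⟩, hux⟩
    have hxK : x ∈ wulffShape f := (isClosed_wulffShape f).frontier_subset hxK
    have hxv : inner ℝ x (v : RSpace n) = f v := by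
      rw [← hf.supportFn_wulffShape hff v]; exact hxH
    have hx0 : x ≠ 0 := by
      rintro rfl
      rw [inner_zero_left] at hxv
      exact (hf.pos v).ne hxv
    have hn : 0 < ‖x‖ := norm_pos_iff.2 hx0
    have hP : polarFn f x = 1 := by
      refine le_antisymm (hf.mem_wulffShape_iff.1 hxK) ?_
      have h := hf.le_polarFn x v
      rwa [hxv, div_self (hf.pos v).ne'] at h
    rw [IsNormal, dualFn, hux, polarFn_smul f (inv_pos.2 hn).le, hP, real_inner_smul_left, hxv,
      mul_one]
  · intro hv
    have hmem := (hf.mem_supportingHyperplane_iff hff u v).2 hv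
    have hρ : 0 < radialFn (wulffShape f) u := by
      rw [hf.radialFn_wulffShape]; exact inv_pos.2 hu0
    set x := radialFn (wulffShape f) u • (u : RSpace n) with hx
    have hxK : x ∈ wulffShape f := by
      rw [hx, hf.smul_mem_wulffShape_iff hρ, hf.radialFn_wulffShape]
    have hxv : inner ℝ x (v : RSpace n) = f v := by
      rw [← hf.supportFn_wulffShape hff v]; exact hmem
    refine ⟨x, ⟨⟨subset_closure hxK, fun hint => ?_⟩, hmem⟩, ?_⟩
    -- A point with `⟨x, v⟩ = f v` is not interior: a small move along `v` violates the constraint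
    -- at `v`.
    · obtain ⟨ε, hε, hball⟩ := Metric.mem_nhds_iff.1 (mem_interior_iff_mem_nhds.1 hint)
      have h : x + (ε / 2) • (v : RSpace n) ∈ wulffShape f := hball (by
        rw [Metric.mem_ball, dist_eq_norm, add_sub_cancel_left, norm_smul, norm_coe_sphere,
          Real.norm_of_nonneg (by positivity)]
        linarith)
      have h2 := h v
      rw [inner_add_left, hxv, real_inner_smul_left, inner_self_sphere] at h2
      linarith
    · rw [hx, norm_smul, norm_coe_sphere, mul_one, Real.norm_of_nonneg hρ.le, smul_smul,
        inv_mul_cancel₀ hρ.ne', one_smul]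

/-- The two sets can differ only at directions without a unique normal, which are null. This
replaces the image by a preimage, so that it becomes null-measurable for Borel `A`. -/
theorem reverseRadialGaussImage_ae_eq (hf : PosCont f) (hff : dualFn (dualFn f) = f)
    (A : Set (USphere n)) :
    reverseRadialGaussImage (wulffShape f) A =ᵐ[sphereMeasure n] normalMap f ⁻¹' A := by
  filter_upwards [ae_existsUnique_isNormal hf] with u hu
  refine propext ?_
  refine (hf.mem_reverseRadialGaussImage_iff hff A u).trans ?_
  simp only [isNormal_iff hu, exists_eq_right]
  rfl

end PosCont

theorem dualOrliczCurvature_wulffShape (hf : PosCont f) (hff : dualFn (dualFn f) = f)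
    (φ : RSpace n → ℝ) (ψ : ℝ → ℝ) (A : Set (USphere n)) :
    dualOrliczCurvature φ ψ (wulffShape f) A = (1 / (n : ℝ)) *
      ∫ u in normalMap f ⁻¹' A, radialDensity φ f u / ψ (f (normalMap f u))
        ∂(sphereMeasure n) := by
  rw [dualOrliczCurvature, setIntegral_congr_set (hf.reverseRadialGaussImage_ae_eq hff A)]
  simp only [hf.radialFn_wulffShape, hf.radialGaussMap_wulffShape hff, hf.supportFn_wulffShape hff,
    radialDensity]

/-! ### Lagrange multiplier and passage to measures -/

/-- Two positive functionals, one of which is nonnegative wherever the other is positive, are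
proportional. -/
theorem exists_pos_eq_smul {E : Type*} [AddCommGroup E] [Module ℝ E] (A B : E →ₗ[ℝ] ℝ) (e : E)
    (hA : 0 < A e) (hB : 0 < B e) (h : ∀ g, 0 < A g → 0 ≤ B g) :
    ∃ c > 0, ∀ g, B g = c * A g := by
  have h' : ∀ g, 0 ≤ A g → 0 ≤ B g := by
    intro g hg
    by_contra! hlt
    -- The coefficient is half of what would bring `B` to zero: `A` becomes positive while `B`
    -- equals `B g / 2 < 0`.
    have h1 := h (g + (-B g / (2 * B e)) • e) (by
      rw [map_add, map_smul, smul_eq_mul]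
      have : 0 < -B g / (2 * B e) * A e := mul_pos (div_pos (by linarith) (by linarith)) hA
      linarith)
    rw [map_add, map_smul, smul_eq_mul] at h1
    have h2 : -B g / (2 * B e) * B e = -B g / 2 := by field_simp
    linarith
  refine ⟨B e / A e, div_pos hB hA, fun g => ?_⟩
  -- On the kernel of `A`, both an element and its negative have nonnegative `B`, so `B` vanishes
  -- there.
  have h0 : A (g - (A g / A e) • e) = 0 := by
    rw [map_sub, map_smul, smul_eq_mul, div_mul_cancel₀ _ hA.ne', sub_self]
  have h1 := h' _ h0.ge
  have h2 := h' (-(g - (A g / A e) • e)) (by rw [map_neg, h0, neg_zero])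
  rw [map_neg] at h2
  rw [map_sub, map_smul, smul_eq_mul] at h1 h2
  have h3 : B g = A g / A e * B e := by linarith
  rw [h3]; ring

theorem integrable_mul_comp_normalMap (hf : PosCont f) {w g : USphere n → ℝ} (hw : Continuous w)
    (hg : Continuous g) : Integrable (fun u => w u * g (normalMap f u)) (sphereMeasure n) := by
  obtain ⟨C, hC⟩ := isCompact_univ.exists_bound_of_continuousOn hw.continuousOn
  obtain ⟨D, hD⟩ := isCompact_univ.exists_bound_of_continuousOn hg.continuousOn
  refine Integrable.of_bound (hw.aestronglyMeasurable.mul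
    (hg.measurable.comp_aemeasurable hf.aemeasurable_normalMap).aestronglyMeasurable) (C * D)
    (Eventually.of_forall fun u => ?_)
  rw [norm_mul]
  have h := hC u (mem_univ u)
  exact mul_le_mul h (hD _ (mem_univ _)) (norm_nonneg _) ((norm_nonneg _).trans h)

omit [Nonempty (USphere n)] in
/-- Positive continuous functions have positive integral against nonzero finite measures. -/
theorem PosCont.integral_pos (hf : PosCont f) (ν : Measure (USphere n)) [IsFiniteMeasure ν]
    (hν : ν ≠ 0) : 0 < ∫ u, f u ∂ν := by
  rw [integral_pos_iff_support_of_nonneg (fun v => (hf.pos v).le)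
    (integrable_of_continuous hf.cont ν)]
  have : Function.support f = univ := eq_univ_of_forall fun v => (hf.pos v).ne'
  rw [this]
  exact Measure.measure_univ_pos.2 hν

/-- The Euler–Lagrange equation in weak form: a first order condition for positive functionals
turns into proportionality. -/
theorem exists_multiplier {w q : USphere n → ℝ} (hf : PosCont f) (hw : PosCont w) (hq : PosCont q)
    {μ : Measure (USphere n)} [IsFiniteMeasure μ] (hμ : μ ≠ 0)
    (h : ∀ g : USphere n → ℝ, Continuous g →
      0 < ∫ u, w u * g (normalMap f u) ∂(sphereMeasure n) → 0 ≤ ∫ v, q v * g v ∂μ) :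
    ∃ c > 0, ∀ g : USphere n → ℝ, Continuous g →
      ∫ v, q v * g v ∂μ = c * ∫ u, w u * g (normalMap f u) ∂(sphereMeasure n) := by
  let A : C(USphere n, ℝ) →ₗ[ℝ] ℝ :=
    { toFun := fun g => ∫ u, w u * g (normalMap f u) ∂(sphereMeasure n)
      map_add' := fun g g' => by
        rw [← integral_add (integrable_mul_comp_normalMap hf hw.cont g.continuous)
          (integrable_mul_comp_normalMap hf hw.cont g'.continuous)]
        simp only [ContinuousMap.add_apply, mul_add]
      map_smul' := fun a g => by
        simp only [ContinuousMap.smul_apply, smul_eq_mul, RingHom.id_apply,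
          ← integral_const_mul, mul_left_comm] }
  let B : C(USphere n, ℝ) →ₗ[ℝ] ℝ :=
    { toFun := fun g => ∫ v, q v * g v ∂μ
      map_add' := fun g g' => by
        simp only [ContinuousMap.add_apply, mul_add]
        exact integral_add (integrable_of_continuous (hq.cont.mul g.continuous) μ)
          (integrable_of_continuous (hq.cont.mul g'.continuous) μ)
      map_smul' := fun a g => by
        simp only [ContinuousMap.smul_apply, smul_eq_mul, RingHom.id_apply,
          ← integral_const_mul, mul_left_comm] }
  have hσ : sphereMeasure n ≠ 0 := NeZero.ne _
  obtain ⟨c, hc, hcg⟩ := exists_pos_eq_smul A B 1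
    (by simpa [A] using hw.integral_pos (sphereMeasure n) hσ)
    (by simpa [B] using hq.integral_pos μ hμ) fun g hg => h g g.continuous hg
  exact ⟨c, hc, fun g hg => hcg ⟨g, hg⟩⟩

/-- The weak equation against continuous functions implies the equation of measures. -/
theorem measureReal_eq_setIntegral {w : USphere n → ℝ} (hf : PosCont f)
    {μ : Measure (USphere n)} [IsFiniteMeasure μ]
    (hw : Integrable w (sphereMeasure n)) (hw0 : ∀ u, 0 ≤ w u)
    (h : ∀ g : USphere n → ℝ, Continuous g →
      ∫ v, g v ∂μ = ∫ u, w u * g (normalMap f u) ∂(sphereMeasure n))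
    {A : Set (USphere n)} (hA : MeasurableSet A) :
    μ.real A = ∫ u in normalMap f ⁻¹' A, w u ∂(sphereMeasure n) := by
  set ν := (sphereMeasure n).withDensity fun u => ENNReal.ofReal (w u) with hν
  have hfin : IsFiniteMeasure ν := isFiniteMeasure_withDensity_ofReal hw.2
  have hm : AEMeasurable (normalMap f) ν :=
    hf.aemeasurable_normalMap.mono_ac (withDensity_absolutelyContinuous _ _)
  -- A finite Borel measure on the sphere is determined by its integrals of continuous functions.
  have hμν : μ = ν.map (normalMap f) := by
    refine ext_of_forall_integral_eq_of_IsFiniteMeasure fun g => ?_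
    rw [h g g.continuous, integral_map hm g.continuous.aestronglyMeasurable, hν,
      integral_withDensity_eq_integral_toReal_smul₀ hw.aemeasurable.ennreal_ofReal
        (Eventually.of_forall fun _ => ENNReal.ofReal_lt_top)]
    simp only [ENNReal.toReal_ofReal (hw0 _), smul_eq_mul]
  have hpre : NullMeasurableSet (normalMap f ⁻¹' A) (sphereMeasure n) :=
    hf.aemeasurable_normalMap.nullMeasurableSet_preimage hA
  rw [measureReal_def, hμν, Measure.map_apply_of_aemeasurable hm hA, hν,
    withDensity_apply₀ _ hpre, integral_eq_lintegral_of_nonneg_ae (Eventually.of_forall hw0)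
      hw.1.restrict]

end DualOrlicz

/-! ### The main theorem -/

theorem mainTheorem12 (n : ℕ) (hn : 1 ≤ n)
    (μ : Measure (DualOrlicz.USphere n)) [IsFiniteMeasure μ] (hμ : μ ≠ 0)
    (hμconc : DualOrlicz.NotConcentratedOnHemisphere μ)
    (φ : DualOrlicz.RSpace n → ℝ)
    (hφcont : ContinuousOn φ {x | x ≠ 0}) (hφpos : ∀ x, x ≠ 0 → 0 < φ x)
    (hΦfin : ∀ t : ℝ, 0 < t → ∀ u : DualOrlicz.USphere n, DualOrlicz.PhiBar φ (t, u) ≠ ∞)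
    (hΦcont : ContinuousOn (DualOrlicz.PhiBar φ) (Ioi (0 : ℝ) ×ˢ univ))
    (hcone : ∀ (v : DualOrlicz.USphere n) (c : ℝ), 0 < c → c < 1 →
      Tendsto (fun b : ℝ => DualOrlicz.phiVolume φ (DualOrlicz.truncatedCone v b c))
        (𝓝[>] 0) (𝓝 ∞))
    (ψ : ℝ → ℝ) (hψcont : ContinuousOn ψ (Ioi 0)) (hψpos : ∀ s, 0 < s → 0 < ψ s)
    (hψint : ∫⁻ s in Ioi (1 : ℝ), ENNReal.ofReal (ψ s / s) = ∞) :
    ∃ K : ConvexBody (DualOrlicz.RSpace n),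
      (0 : DualOrlicz.RSpace n) ∈ interior (K : Set (DualOrlicz.RSpace n)) ∧
      DualOrlicz.dualOrliczCurvature φ ψ (K : Set (DualOrlicz.RSpace n)) univ ≠ 0 ∧
      ∀ A : Set (DualOrlicz.USphere n), MeasurableSet A →
        μ.real A / μ.real univ =
          DualOrlicz.dualOrliczCurvature φ ψ (K : Set (DualOrlicz.RSpace n)) A /
            DualOrlicz.dualOrliczCurvature φ ψ (K : Set (DualOrlicz.RSpace n)) univ := by
  have hS := DualOrlicz.nonempty_sphere hn
  have hφ : DualOrlicz.Admissible φ := ⟨hφcont, hφpos, hΦfin, hΦcont⟩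
  have h1 : DualOrlicz.PosCont (fun _ : DualOrlicz.USphere n => (1 : ℝ)) :=
    ⟨continuous_const, fun _ => one_pos⟩
  obtain ⟨r, hr, hlow⟩ := hφ.exists_le_of_dualVolume_le hn hcone (hφ.dualVolume_ne_top h1)
  obtain ⟨f, hf, hff, hfV, hmin⟩ :=
    DualOrlicz.exists_minimizer hφ hψcont hψpos hψint hr hμconc hlow
  have hw := hφ.posCont_radialDensity hf
  have hq : DualOrlicz.PosCont fun v => ψ (f v) :=
    ⟨hψcont.comp_continuous hf.cont hf.pos, fun v => hψpos _ (hf.pos v)⟩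
  obtain ⟨c, hc, hcg⟩ := DualOrlicz.exists_multiplier hf hw hq hμ fun g hg hpos =>
    DualOrlicz.integral_nonneg_of_minimizer hφ hn hψcont hr hf hfV hmin hg hpos
  have hint : Integrable (fun u => c * (DualOrlicz.radialDensity φ f u /
      ψ (f (DualOrlicz.normalMap f u)))) (DualOrlicz.sphereMeasure n) :=
    (DualOrlicz.integrable_mul_comp_normalMap hf hw.cont hq.inv.cont).const_mul c
  have hμA : ∀ A : Set (DualOrlicz.USphere n), MeasurableSet A → μ.real A =
      c * n * DualOrlicz.dualOrliczCurvature φ ψ (DualOrlicz.wulffShape f) A := by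
    intro A hA
    have hn0 : (n : ℝ) ≠ 0 := by positivity
    rw [DualOrlicz.measureReal_eq_setIntegral hf hint
      (fun u => mul_nonneg hc.le (div_nonneg (hw.pos u).le (hq.pos _).le)) ?_ hA,
      DualOrlicz.dualOrliczCurvature_wulffShape hf hff, integral_const_mul]
    · field_simp
    · intro g hg
      -- Testing with `g / ψ(f)` moves the factor `ψ(f)` from the side of `μ` to the spherical
      -- integral.
      have h2 := hcg (fun v => (ψ (f v))⁻¹ * g v) (hq.inv.cont.mul hg)
      have h3 : ∀ v, ψ (f v) * ((ψ (f v))⁻¹ * g v) = g v := fun v =>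
        mul_inv_cancel_left₀ (hq.pos v).ne' _
      simp only [h3] at h2
      rw [h2, ← integral_const_mul]
      exact integral_congr_ae (Eventually.of_forall fun u => by
        simp only [div_eq_mul_inv, mul_assoc])
  have hμ0 : μ.real univ ≠ 0 := by
    rw [measureReal_def, ENNReal.toReal_ne_zero]
    exact ⟨Measure.measure_univ_ne_zero.2 hμ, measure_ne_top _ _⟩
  have hcn : c * n ≠ 0 := mul_ne_zero hc.ne' (by positivity)
  refine ⟨DualOrlicz.wulffBody hf, hf.zero_mem_interior_wulffShape, fun h0 => hμ0 ?_,
    fun A hA => ?_⟩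
  · rw [hμA univ MeasurableSet.univ]
    exact mul_eq_zero_of_right _ h0
  -- The unknown multiplier `c n` cancels in the normalized quotient.
  · rw [hμA A hA, hμA univ MeasurableSet.univ, mul_div_mul_left _ _ hcn]
    rfl
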